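/- **Setting.** Let $\Omega\subset\mathbb R^2$ be open, $0<T\le\infty$, $\nu\ge 0$, let $U\subset\mathbb R^\nu$ be a closed set of states, and let the flux $\mathbb F=(F_0,F_1)$ be Lipschitz continuous on $U$. Consider $\partial_t q+\nabla\cdot\mathbb F(q)=0$ in $\Omega\times[0,T)$. A *scheme* consists of the following. * A tessellation of $\overline\Omega$ by finitely many closed polygonal cells $\omega_i$ with disjoint interiors. Each cell is split without overlap into the triangles joining a center of the cell to its edges; every edge is either shared with exactly one edge of a neighbouring cell or lies on $\partial\Omega$. Each $\omega_i$ is subdivided into triangular subcells $\tau_{i,\alpha}$ with centroids $\mathbf x_{i,\alpha}$, and $B_{i,\alpha}\supset\tau_{i,\alpha}$ is a closed ball centered at $\mathbf x_{i,\alpha}$. The mesh size is $h=\max_i\operatorname{diam}\omega_i$. * Time levels $0=t^0<t^1<\dots$ that reach every time before $T$; $\Delta t=t^{n+1}-t^n$ may depend on $n$. * A set of discrete functions on $\overline\Omega$ with values in $U$ that contains the constants in $U$, and a discrete solution $q_h^n$ ($n\ge0$) in this set, integrable on $\overline\Omega$. Put $q_h(\mathbf x,t)=q_h^n(\mathbf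 x)$ for $t\in[t^n,t^{n+1})$, and let $\bar q_i^n$ be the average of $q_h^n$ over $\omega_i$. * For each edge $\ell$ of each cell $\omega_i$ and each time step, a numerical flux $\mathbf F_{\mathbf n_{i\ell}}=\mathbf F^n_{\mathbf n_{i\ell}}(u)$, a function of the discrete function $u$. With $\mathbf n_{i\ell}$ the outward normal scaled by the length $|\mathbf n_{i\ell}|$ of the edge, the fluxes through interior edges are conservative (the fluxes seen from the two sides of an edge add up to $0$), consistent ($\mathbf F_{\mathbf n_{i\ell}}(u)=\mathbb F(c)\cdot\mathbf n_{i\ell}$ if $u\equiv c\in U$), and Lipschitz continuous: $\|\mathbf F_{\mathbf n_{i\ell}}(u)-\mathbf F_{\mathbf n_{i\ell}}(v)\|\le L\,|\mathbf n_{i\ell}|\,\sup\|u-v\|$, with the supremum over the points of $\overline\Omega$ in the balls $B_{j,\alpha}$ of the two cells $\omega_j$ sharing the edge. Nothing is assumed on boundary fluxes. **Proposition.** Consider a sequence of such schemes with $h\to0$ and $\sup_{n:\,t^n<T}\Delta t\to0$, with the same $L$, on shape-regular meshes: for some $\sigma>0$ independent of the scheme, every cell $\omega_i$ contains a ball of radius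 $\operatorname{diam}(\omega_i)/\sigma$ and has perimeter at most $\sigma\operatorname{diam}(\omega_i)$. Assume that, with a conservation defect $\Delta_i^n\in\mathbb R^\nu$, $$|\omega_i|\,\frac{\bar q_i^{\,n+1}-\bar q_i^{\,n}}{\Delta t}+\sum_\ell \mathbf F^n_{\mathbf n_{i\ell}}(q_h^n)=|\omega_i|\,\Delta_i^n\qquad\text{for all } i \text{ and all } n \text{ with } t^n<T .$$ Let $q_0\in L^1_{loc}(\Omega;\mathbb R^\nu)$ and $q\in L^1_{loc}(\Omega\times[0,T);\mathbb R^\nu)$, and assume that, as $h\to0$: 1. $\int_\Omega (q_h^0-q_0)\,\psi\,d\mathbf x\to0$ for all $\psi\in C_0^\infty(\Omega)$; 2. $h^2\sum_i\sum_\alpha\sup_{\mathbf x\in B_{i,\alpha}\cap\overline\Omega}\|q_h^n(\mathbf x)-q_h^n(\mathbf x_{i,\alpha})\|\to0$, uniformly over all $n$ with $t^n<T$; 3. $\sup_{i,\;n:\,t^n<T}\|\Delta_i^n\|\to0$; 4. $q_h\to q$ in $L^1(K)$ for every compact $K\subset\Omega\times[0,T)$. Then $q$ is a weak solution of the conservation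 law with initial datum $q_0$: $q\in U$ almost everywhere, $\mathbb F(q)\in L^1_{loc}(\Omega\times[0,T))$, and for all $\phi\in C_0^\infty(\Omega\times[0,T))$ (not required to vanish at $t=0$) $$\int_\Omega q_0\,\phi(\cdot,0)\,d\mathbf x+\int_0^T\!\!\int_\Omega q\,\partial_t\phi\,d\mathbf x\,dt+\int_0^T\!\!\int_\Omega\mathbb F(q)\cdot\nabla\phi\,d\mathbf x\,dt=0 .$$ -/

import Mathlib

open MeasureTheory Filter Topology
open scoped ContDiff ENNReal

noncomputable section

/-- The physical plane, with its Euclidean norm and Lebesgue measure. -/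
abbrev Plane : Type := EuclideanSpace ℝ (Fin 2)

/-- The space of conserved states, with `ν` components. -/
abbrev State (ν : ℕ) : Type := EuclideanSpace ℝ (Fin ν)

/-- Twice the signed area of the triangle `(c, a, b)`; positive iff it is counterclockwise. -/
def orient (c a b : Plane) : ℝ :=
  (a 0 - c 0) * (b 1 - c 1) - (a 1 - c 1) * (b 0 - c 0)

/-- The normal to the oriented segment from `a` to `b`, on its right-hand side (outward for a
counterclockwise polygon), scaled by the length of the segment. -/
def scaledNormal (a b : Plane) : Plane := !₂[b 1 - a 1, a 0 - b 0]

/-! ### Polygonal cells and their subcells -/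

/-- A polygonal cell: a closed polygon with counterclockwise vertices, split without overlap into
the triangles that join its center to its edges; together with a subdivision into triangular
subcells and, for each subcell, the radius of a ball around its center that contains it. -/
structure PolygonalCell where
  /-- number of vertices, which is also the number of edges -/
  nv : ℕ
  three_le_nv : 3 ≤ nv
  /-- the vertices; edge `k` goes from vertex `k` to its cyclic successor -/
  vertex : Fin nv → Plane
  center : Plane
  orient_pos : ∀ k, 0 < orient center (vertex k) (vertex (finRotate nv k))
  fan_disjoint : ∀ k l, k ≠ l →
    Disjoint (interior (convexHull ℝ {center, vertex k, vertex (finRotate nv k)}))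
      (interior (convexHull ℝ {center, vertex l, vertex (finRotate nv l)}))
  /-- number of subcells -/
  nsub : ℕ
  /-- the three vertices of each subcell -/
  subVertex : Fin nsub → Fin 3 → Plane
  subVertex_indep : ∀ a, AffineIndependent ℝ (subVertex a)
  sub_disjoint : ∀ a b, a ≠ b →
    Disjoint (interior (convexHull ℝ (Set.range (subVertex a))))
      (interior (convexHull ℝ (Set.range (subVertex b))))
  sub_cover : (⋃ a, convexHull ℝ (Set.range (subVertex a))) =
    ⋃ k, convexHull ℝ {center, vertex k, vertex (finRotate nv k)}
  /-- radius of the ball attached to each subcell -/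
  radius : Fin nsub → ℝ
  sub_subset_ball : ∀ a, convexHull ℝ (Set.range (subVertex a)) ⊆
    Metric.closedBall ((1 / 3 : ℝ) • ∑ j, subVertex a j) (radius a)

namespace PolygonalCell

variable (P : PolygonalCell)

/-- The closed region `ω` occupied by the cell. -/
def region : Set Plane :=
  ⋃ k, convexHull ℝ {P.center, P.vertex k, P.vertex (finRotate P.nv k)}

/-- The area `|ω|`. -/
def area : ℝ := volume.real P.region

/-- The first endpoint of edge `k`. -/
def src (k : Fin P.nv) : Plane := P.vertex k

/-- The second endpoint of edge `k`. -/
def tgt (k : Fin P.nv) : Plane := P.vertex (finRotate P.nv k)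

/-- The length of edge `k`. -/
def edgeLength (k : Fin P.nv) : ℝ := dist (P.src k) (P.tgt k)

/-- The perimeter `|∂ω|`. -/
def perimeter : ℝ := ∑ k, P.edgeLength k

/-- The diameter of the cell. -/
def diam : ℝ := Metric.diam P.region

/-- The center (centroid) of subcell `a`. -/
def subCenter (a : Fin P.nsub) : Plane := (1 / 3 : ℝ) • ∑ j, P.subVertex a j

/-- The ball attached to subcell `a`. -/
def subBall (a : Fin P.nsub) : Set Plane := Metric.closedBall (P.subCenter a) (P.radius a)

/-- The union of the balls of all subcells. -/
def patch : Set Plane := ⋃ a, P.subBall a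

/-- Shape regularity with constant `σ`: the cell contains a ball of radius `diam / σ`, and its
perimeter is at most `σ * diam`. -/
def ShapeRegular (σ : ℝ) : Prop :=
  (∃ c, Metric.closedBall c (P.diam / σ) ⊆ P.region) ∧ P.perimeter ≤ σ * P.diam

end PolygonalCell

/-! ### Meshes -/

/-- A tessellation of (the closure of) `Ω` by finitely many non-overlapping polygonal cells. Every
edge is either shared with exactly one edge of a neighbouring cell, traversed in the opposite
direction, or lies on the boundary of `Ω`. (A hanging node counts as a vertex of each cell that it
touches.) -/
structure PolygonalMesh (Ω : Set Plane) where
  ncell : ℕ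
  cell : Fin ncell → PolygonalCell
  cover : (⋃ i, (cell i).region) = closure Ω
  cell_disjoint : ∀ i j, i ≠ j → Disjoint (interior (cell i).region) (interior (cell j).region)
  /-- the opposite edge in the neighbouring cell, or `none` for a boundary edge -/
  opp : (Σ i, Fin (cell i).nv) → Option (Σ i, Fin (cell i).nv)
  opp_symm : ∀ e f, opp e = some f → opp f = some e
  opp_src : ∀ e f, opp e = some f → (cell f.1).src f.2 = (cell e.1).tgt e.2
  opp_tgt : ∀ e f, opp e = some f → (cell f.1).tgt f.2 = (cell e.1).src e.2
  boundary : ∀ e, opp e = none → segment ℝ ((cell e.1).src e.2) ((cell e.1).tgt e.2) ⊆ frontier Ω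

namespace PolygonalMesh

variable {Ω : Set Plane} (M : PolygonalMesh Ω)

/-- The edges, seen from the cell they belong to: the pairs (cell, local number of the edge). -/
abbrev Edge : Type := Σ i, Fin (M.cell i).nv

/-- The outward normal of an edge, scaled by its length. -/
def normal (e : M.Edge) : Plane :=
  scaledNormal ((M.cell e.1).src e.2) ((M.cell e.1).tgt e.2)

/-- The mesh size `h`: the largest diameter of a cell. -/
def size : ℝ := ⨆ i, (M.cell i).diam

end PolygonalMesh

/-! ### Schemes -/

/-- A discretization of `Ω × [0, T)`, `0 < T ≤ ∞`, for systems with `ν` components: a mesh, time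
levels, discrete functions, numerical fluxes, and a discrete solution. -/
structure Scheme (Ω : Set Plane) (T : EReal) (ν : ℕ) where
  mesh : PolygonalMesh Ω
  /-- the time levels `t⁰ = 0 < t¹ < t² < …`, which reach every time before `T` -/
  t : ℕ → ℝ
  t_zero : t 0 = 0
  t_strictMono : StrictMono t
  t_exhaust : ∀ s : ℝ, (s : EReal) < T → ∃ n, s < t n
  /-- the admissible discrete functions (for instance piecewise polynomials) -/
  space : Set (Plane → State ν)
  /-- `flux n e u` is the numerical flux through the edge `e` in the time step from `tⁿ` to
  `tⁿ⁺¹`, computed from the discrete function `u`; it is integrated over the edge and averaged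
  over the time step -/
  flux : ℕ → mesh.Edge → (Plane → State ν) → State ν
  /-- the discrete solution at the time levels -/
  q : ℕ → Plane → State ν
  q_mem : ∀ n, q n ∈ space
  q_integrable : ∀ n, IntegrableOn (q n) (closure Ω)

namespace Scheme

variable {Ω : Set Plane} {T : EReal} {ν : ℕ} (S : Scheme Ω T ν)

/-- The time step from `tⁿ` to `tⁿ⁺¹`. -/
def dt (n : ℕ) : ℝ := S.t (n + 1) - S.t n

/-- The largest of the time steps that start before `T`. -/
def maxStep : ℝ≥0∞ := ⨆ n, ⨆ _ : (S.t n : EReal) < T, ENNReal.ofReal (S.dt n)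

/-- The discrete solution as a function on space-time: it equals `q n` on `[tⁿ, tⁿ⁺¹)`. -/
def qh (p : Plane × ℝ) : State ν := S.q (sInf {n | p.2 < S.t (n + 1)}) p.1

/-- The average of the discrete solution over cell `i` at time level `n`. -/
def avg (n : ℕ) (i : Fin S.mesh.ncell) : State ν := ⨍ x in (S.mesh.cell i).region, S.q n x

/-- The local balance with conservation defect `Δ`:
`|ωᵢ| (q̄ᵢⁿ⁺¹ - q̄ᵢⁿ) / Δt + ∑ₗ F_{n_{iℓ}} = |ωᵢ| Δᵢⁿ`, for every cell and every time step. -/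
def Balance (Δ : ℕ → Fin S.mesh.ncell → State ν) : Prop :=
  ∀ n, (S.t n : EReal) < T → ∀ i,
    (S.mesh.cell i).area • ((S.dt n)⁻¹ • (S.avg (n + 1) i - S.avg n i)) +
      ∑ k, S.flux n ⟨i, k⟩ (S.q n) = (S.mesh.cell i).area • Δ n i

/-- `sup_{i,n} ‖Δᵢⁿ‖`. -/
def supDefect (Δ : ℕ → Fin S.mesh.ncell → State ν) : ℝ≥0∞ :=
  ⨆ n, ⨆ _ : (S.t n : EReal) < T, ⨆ i, ‖Δ n i‖ₑ

/-- `h² ∑ᵢ ∑ₐ max_{x ∈ Bᵢₐ} ‖qₕⁿ(x) - qₕⁿ(xᵢₐ)‖`; the discrete solution lives on the closure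
of `Ω`. -/
def variation (n : ℕ) : ℝ≥0∞ :=
  ENNReal.ofReal (S.mesh.size ^ 2) *
    ∑ i, ∑ a, ⨆ x ∈ (S.mesh.cell i).subBall a ∩ closure Ω,
      ‖S.q n x - S.q n ((S.mesh.cell i).subCenter a)‖ₑ

/-- The largest variation at a time level before `T`. -/
def supVariation : ℝ≥0∞ := ⨆ n, ⨆ _ : (S.t n : EReal) < T, S.variation n

/-- The classical assumptions on the numerical fluxes through interior edges, for the flux
`F = (F₀, F₁)` on the set `U` of states: discrete functions have values in `U`, constants in `U`
are discrete functions, and the numerical flux is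
* conservative: the fluxes through an edge, seen from its two sides, cancel;
* consistent: for a constant discrete function it is the exact flux through the edge;
* Lipschitz continuous, with constant `L` per unit length, with respect to the supremum norm on
  the balls attached to the two cells that share the edge. -/
structure AdmissibleFlux (F : Fin 2 → State ν → State ν) (U : Set (State ν)) (L : ℝ) : Prop where
  values : ∀ u ∈ S.space, ∀ x ∈ closure Ω, u x ∈ U
  const_mem : ∀ c ∈ U, (fun _ : Plane => c) ∈ S.space
  conservative : ∀ n e f, S.mesh.opp e = some f → ∀ u ∈ S.space,
    S.flux n e u + S.flux n f u = 0
  consistent : ∀ n e f, S.mesh.opp e = some f → ∀ c ∈ U,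
    S.flux n e (fun _ => c) = ∑ j, S.mesh.normal e j • F j c
  lipschitz : ∀ n e f, S.mesh.opp e = some f → ∀ u ∈ S.space, ∀ v ∈ S.space, ∀ r : ℝ,
    (∀ x ∈ ((S.mesh.cell e.1).patch ∪ (S.mesh.cell f.1).patch) ∩ closure Ω,
      ‖u x - v x‖ ≤ r) →
    ‖S.flux n e u - S.flux n e v‖ ≤ L * (S.mesh.cell e.1).edgeLength e.2 * r

end Scheme

/-! ### Weak solutions -/

/-- The space-time domain `Ω × [0, T)`. -/
def spaceTime (Ω : Set Plane) (T : EReal) : Set (Plane × ℝ) :=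
  {p | p.1 ∈ Ω ∧ 0 ≤ p.2 ∧ (p.2 : EReal) < T}

/-- `q` is a weak solution on `Ω × [0, T)`, with values in `U`, of `∂ₜ q + ∂₀ F₀(q) + ∂₁ F₁(q) = 0`
with initial datum `q₀`. The test functions are smooth with compact support in `Ω × (-∞, T)`, so
that they need not vanish at time `0`. -/
structure IsWeakSolution {ν : ℕ} (Ω : Set Plane) (T : EReal) (U : Set (State ν))
    (F : Fin 2 → State ν → State ν) (q₀ : Plane → State ν) (q : Plane × ℝ → State ν) : Prop where
  values : ∀ᵐ p ∂(volume.restrict (spaceTime Ω T)), q p ∈ U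
  locInt : LocallyIntegrableOn q (spaceTime Ω T)
  locInt_flux : ∀ j, LocallyIntegrableOn (fun p => F j (q p)) (spaceTime Ω T)
  weak_form : ∀ φ : Plane × ℝ → ℝ, ContDiff ℝ ∞ φ → HasCompactSupport φ →
    tsupport φ ⊆ {p | p.1 ∈ Ω ∧ (p.2 : EReal) < T} →
    (∫ x in Ω, φ (x, 0) • q₀ x) +
      (∫ p in spaceTime Ω T, fderiv ℝ φ p (0, 1) • q p) +
      (∫ p in spaceTime Ω T,
        ∑ j, fderiv ℝ φ p (EuclideanSpace.single j 1, 0) • F j (q p)) = 0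

end

/-! The scheme is tested with the cell averages Φᵢ of φ at the end tⁿ⁺¹ of each time step. Summation
by parts in time produces the initial term and, because q_h is constant in time on each step,
exactly the integral of q_h ∂ₜφ, up to the error of exchanging q_h for its cell averages.

The heart is the flux term (`Scheme.AdmissibleFlux.norm_sum_average_smul_flux_add_le`). Both sides
of an interior edge e see the same mean w_e of φ along e, so by conservation w_e may be subtracted
from Φᵢ for free, and Φᵢ - w_e = O(h). The numerical flux is split into the exact flux of the
constant state cᵢ, the value of q_h at the center of the cell, and a remainder. By consistency and
Lipschitz continuity the remainder is at most L|e| times the oscillations W of q_h on the patches of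
the two cells; by the perimeter bound the remainders contribute O(h · h ∑ Wᵢ). The exact fluxes add
up on each cell to -∫ ∇φ · F(cᵢ), by the divergence theorem and because the normals of a cell sum to
zero. Going back from cᵢ to q_h costs O(∑ |ωᵢ| Wᵢ) = O(h² ∑ Wᵢ).

It remains that h² ∑ Wᵢ → 0, whereas the variation condition only controls deviations on single
balls. A cell is connected, so two of its subcells are joined by a path of successively meeting
subcells that visits none twice. Hence Wᵢ is at most twice the sum of the deviations, however many
subcells there are (`PolygonalCell.edist_le_deviation`).

`Scheme.AdmissibleFlux.norm_weak_residual_le` collects the errors, and `tendsto_integral_smul_comp`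
passes to the limit with L¹ convergence on a compact set. Boundary fluxes get weight zero once h is
below the distance from the support of φ to ∂Ω. The flux is replaced by a Lipschitz extension from U
to the whole space, which is harmless because the limit has values in the closed set U almost
everywhere. -/

/-! ### The divergence theorem on a triangle -/

/-- The mean value of `ψ` along the segment from `a` to `b`. -/
noncomputable def segmentMean (ψ : Plane → ℝ) (a b : Plane) : ℝ := ∫ s in (0 : ℝ)..1, ψ (a + s • (b - a))

lemma segmentMean_comm (ψ : Plane → ℝ) (a b : Plane) :
    segmentMean ψ a b = segmentMean ψ b a := by
  have h := intervalIntegral.integral_comp_sub_left (a := 0) (b := 1)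
    (fun s : ℝ => ψ (b + s • (a - b))) 1
  simp only [sub_self, sub_zero] at h
  rw [segmentMean, segmentMean, ← h]
  congr 1
  ext s
  congr 1
  module

lemma scaledNormal_swap (a b : Plane) : scaledNormal b a = -scaledNormal a b := by
  ext i
  fin_cases i <;> simp [scaledNormal]

/-- The standard triangle in the plane. -/
def stdTriangle : Set (ℝ × ℝ) := {p | 0 ≤ p.1 ∧ 0 ≤ p.2 ∧ p.1 + p.2 ≤ 1}

lemma isClosed_stdTriangle : IsClosed stdTriangle :=
  (isClosed_le continuous_const continuous_fst).inter
    ((isClosed_le continuous_const continuous_snd).inter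
      (isClosed_le (continuous_fst.add continuous_snd) continuous_const))

lemma isCompact_stdTriangle : IsCompact stdTriangle := by
  refine (isCompact_Icc (a := ((0 : ℝ), (0 : ℝ))) (b := (1, 1))).of_isClosed_subset
    isClosed_stdTriangle ?_
  rintro ⟨s, t⟩ ⟨h1, h2, h3⟩
  simp only at h1 h2 h3
  exact ⟨⟨h1, h2⟩, ⟨by simp only; linarith, by simp only; linarith⟩⟩

lemma setIntegral_stdTriangle {f : ℝ × ℝ → ℝ} (hf : Continuous f) :
    ∫ p in stdTriangle, f p = ∫ s in (0 : ℝ)..1, ∫ t in (0 : ℝ)..(1 - s), f (s, t) := by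
  have hm := isClosed_stdTriangle.measurableSet
  have hi : IntegrableOn f stdTriangle := hf.continuousOn.integrableOn_compact isCompact_stdTriangle
  rw [← integral_indicator hm, Measure.volume_eq_prod, integral_prod]
  · rw [intervalIntegral.integral_of_le zero_le_one, ← integral_Icc_eq_integral_Ioc,
      ← integral_indicator measurableSet_Icc]
    congr 1
    ext s
    by_cases hs : s ∈ Set.Icc (0 : ℝ) 1
    · rw [Set.indicator_of_mem hs, intervalIntegral.integral_of_le (by linarith [hs.2]),
        ← integral_Icc_eq_integral_Ioc, ← integral_indicator measurableSet_Icc]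
      congr 1
      ext t
      by_cases ht : t ∈ Set.Icc (0 : ℝ) (1 - s)
      · rw [Set.indicator_of_mem ht, Set.indicator_of_mem]
        exact ⟨hs.1, ht.1, by simp only; linarith [ht.2]⟩
      · rw [Set.indicator_of_notMem ht, Set.indicator_of_notMem]
        rintro ⟨h1, h2, h3⟩
        exact ht ⟨h2, by simp only at h3; linarith⟩
    · rw [Set.indicator_of_notMem hs]
      refine (integral_congr_ae (.of_forall fun t => ?_)).trans (integral_zero ℝ ℝ)
      refine Set.indicator_of_notMem ?_ _
      rintro ⟨h1, h2, h3⟩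
      simp only at h1 h2 h3
      exact hs ⟨h1, by linarith⟩
  · rw [← Measure.volume_eq_prod]
    exact (integrable_indicator_iff hm).2 hi

lemma setIntegral_stdTriangle_swap (f : ℝ × ℝ → ℝ) :
    ∫ p in stdTriangle, f p = ∫ p in stdTriangle, f p.swap := by
  have h := (Measure.measurePreserving_swap (μ := (volume : Measure ℝ)) (ν := (volume : Measure ℝ)))
  have h2 := h.setIntegral_preimage_emb MeasurableEquiv.prodComm.measurableEmbedding f stdTriangle
  rw [← Measure.volume_eq_prod] at h2
  rw [← h2]
  congr 2
  ext ⟨s, t⟩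
  simp only [stdTriangle, Set.mem_preimage, Set.mem_ofPred_eq, Prod.swap]
  constructor <;> rintro ⟨h1, h2, h3⟩ <;> exact ⟨h2, h1, by linarith⟩

/-- The linear map that sends the standard basis to `v`, `w`. -/
noncomputable def pairMap (v w : Plane) : Plane →L[ℝ] Plane :=
  (EuclideanSpace.proj (0 : Fin 2)).smulRight v + (EuclideanSpace.proj (1 : Fin 2)).smulRight w

lemma pairMap_apply (v w x : Plane) : pairMap v w x = x 0 • v + x 1 • w := by
  simp [pairMap]

lemma det_pairMap (v w : Plane) : (pairMap v w).det = v 0 * w 1 - v 1 * w 0 := by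
  rw [ContinuousLinearMap.det,
    ← LinearMap.det_toMatrix (EuclideanSpace.basisFun (Fin 2) ℝ).toBasis, Matrix.det_fin_two]
  simp [LinearMap.toMatrix_apply, pairMap_apply]
  ring

lemma image_stdTriangle (c a b : Plane) :
    (fun x : Plane => c + pairMap (a - c) (b - c) x) '' {x | (x 0, x 1) ∈ stdTriangle} =
      convexHull ℝ {c, a, b} := by
  apply Set.Subset.antisymm
  · rintro _ ⟨x, ⟨h0, h1, h2⟩, rfl⟩
    simp only at h0 h1 h2
    have hc : c ∈ convexHull ℝ {c, a, b} := subset_convexHull ℝ _ (by simp)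
    have ha : a ∈ convexHull ℝ {c, a, b} := subset_convexHull ℝ _ (by simp)
    have hb : b ∈ convexHull ℝ {c, a, b} := subset_convexHull ℝ _ (by simp)
    have := (convex_convexHull ℝ {c, a, b}).sum_mem (t := Finset.univ)
      (w := ![1 - x 0 - x 1, x 0, x 1]) (z := ![c, a, b])
      (by intro i _; fin_cases i <;> simp <;> linarith)
      (by simp [Fin.sum_univ_three]; ring)
      (by intro i _; fin_cases i <;> simpa)
    simp only [Fin.sum_univ_three, Matrix.cons_val_zero, Matrix.cons_val_one,
      Matrix.cons_val] at this
    simp only [pairMap_apply]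
    convert this using 1
    module
  · apply convexHull_min
    · rintro y (rfl | rfl | rfl)
      · exact ⟨0, by simp [stdTriangle], by simp⟩
      · exact ⟨EuclideanSpace.single 0 1, by simp [stdTriangle], by simp [pairMap_apply]⟩
      · exact ⟨EuclideanSpace.single 1 1, by simp [stdTriangle], by simp [pairMap_apply]⟩
    · have hs : Convex ℝ {x : Plane | (x 0, x 1) ∈ stdTriangle} := by
        rintro x ⟨h0, h1, h2⟩ y ⟨k0, k1, k2⟩ α β hα hβ hαβ
        simp only at h0 h1 h2 k0 k1 k2
        refine ⟨?_, ?_, ?_⟩ <;> simp <;> nlinarith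
      have := (hs.linear_image (pairMap (a - c) (b - c)).toLinearMap).vadd c
      convert this using 1
      ext y
      simp [Set.mem_vadd_set]

lemma setIntegral_triangle {c a b : Plane} (h : 0 < orient c a b) (f : Plane → ℝ) :
    ∫ x in convexHull ℝ {c, a, b}, f x =
      orient c a b * ∫ p in stdTriangle, f (c + p.1 • (a - c) + p.2 • (b - c)) := by
  have hdet : (pairMap (a - c) (b - c)).det = orient c a b := by
    rw [det_pairMap]; simp [orient]
  have hemb : MeasurableEmbedding (fun x : Plane => (x 0, x 1)) :=
    (MeasurableEquiv.finTwoArrow.measurableEmbedding).comp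
      (MeasurableEquiv.toLp 2 (Fin 2 → ℝ)).symm.measurableEmbedding
  have hmp : MeasurePreserving (fun x : Plane => (x 0, x 1)) :=
    (volume_preserving_finTwoArrow ℝ).comp (PiLp.volume_preserving_ofLp (Fin 2))
  have hm : MeasurableSet {x : Plane | (x 0, x 1) ∈ stdTriangle} :=
    hemb.measurable isClosed_stdTriangle.measurableSet
  rw [← image_stdTriangle, integral_image_eq_integral_abs_det_fderiv_smul volume hm
    (f' := fun _ => pairMap (a - c) (b - c))]
  · simp only [hdet, abs_of_pos h, smul_eq_mul]
    rw [integral_const_mul, ← hmp.setIntegral_preimage_emb hemb]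
    simp only [pairMap_apply, add_assoc]
    rfl
  · intro x _
    exact ((pairMap (a - c) (b - c)).hasFDerivAt.const_add c).hasFDerivWithinAt
  · apply Function.Injective.injOn
    have hu : IsUnit (pairMap (a - c) (b - c)).toLinearMap :=
      (LinearMap.isUnit_iff_isUnit_det _).2 (by
        have : LinearMap.det (pairMap (a - c) (b - c)).toLinearMap = orient c a b := hdet
        rw [this]; exact h.ne'.isUnit)
    intro x y hxy
    exact ((Module.End.isUnit_iff _).1 hu).1 (add_left_cancel hxy)

/-- The integral over a triangle, in affine coordinates, of the derivative along the side from `c`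
to `b`. -/
lemma setIntegral_stdTriangle_fderiv {ψ : Plane → ℝ} (hψ : ContDiff ℝ 1 ψ) (c a b : Plane) :
    ∫ p in stdTriangle, fderiv ℝ ψ (c + p.1 • (a - c) + p.2 • (b - c)) (b - c) =
      segmentMean ψ a b - segmentMean ψ c a := by
  have hd : Continuous (fderiv ℝ ψ) := hψ.continuous_fderiv one_ne_zero
  rw [setIntegral_stdTriangle (by fun_prop)]
  have key : ∀ s : ℝ, ∫ t in (0 : ℝ)..(1 - s), fderiv ℝ ψ (c + s • (a - c) + t • (b - c)) (b - c) =
      ψ (c + s • (a - c) + (1 - s) • (b - c)) - ψ (c + s • (a - c)) := by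
    intro s
    have := intervalIntegral.integral_eq_sub_of_hasDerivAt (a := 0) (b := 1 - s)
      (f := fun t : ℝ => ψ (c + s • (a - c) + t • (b - c)))
      (f' := fun t : ℝ => fderiv ℝ ψ (c + s • (a - c) + t • (b - c)) (b - c)) ?_ ?_
    · simpa using this
    · intro t _
      have h1 : HasDerivAt (fun t : ℝ => c + s • (a - c) + t • (b - c)) (b - c) t := by
        simpa using ((hasDerivAt_id t).smul_const (b - c)).const_add (c + s • (a - c))
      exact ((hψ.differentiable one_ne_zero _).hasFDerivAt).comp_hasDerivAt t h1
    · exact (by fun_prop : Continuous _).intervalIntegrable _ _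
  simp only [key]
  have hc := hψ.continuous
  rw [intervalIntegral.integral_sub ((by fun_prop : Continuous _).intervalIntegrable _ _)
    ((by fun_prop : Continuous _).intervalIntegrable _ _), segmentMean_comm ψ a b]
  simp only [segmentMean]
  congr 2
  ext s
  congr 1
  module

/-- Exchanging the two affine coordinates exchanges `a` and `b`. The previous identity does not
involve the orientation, so it applies to the reflected triangle. -/
lemma setIntegral_stdTriangle_fderiv' {ψ : Plane → ℝ} (hψ : ContDiff ℝ 1 ψ) (c a b : Plane) :
    ∫ p in stdTriangle, fderiv ℝ ψ (c + p.1 • (a - c) + p.2 • (b - c)) (a - c) =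
      segmentMean ψ a b - segmentMean ψ b c := by
  have hd : Continuous (fderiv ℝ ψ) := hψ.continuous_fderiv one_ne_zero
  rw [setIntegral_stdTriangle_swap, segmentMean_comm ψ a b, segmentMean_comm ψ b c,
    ← setIntegral_stdTriangle_fderiv hψ c b a]
  congr 1
  ext p
  simp only [Prod.swap]
  congr 2
  module

/-- The divergence theorem on a triangle. -/
lemma setIntegral_triangle_fderiv {ψ : Plane → ℝ} (hψ : ContDiff ℝ 1 ψ) {c a b : Plane}
    (h : 0 < orient c a b) (j : Fin 2) :
    ∫ x in convexHull ℝ {c, a, b}, fderiv ℝ ψ x (EuclideanSpace.single j 1) =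
      segmentMean ψ a b * scaledNormal a b j + segmentMean ψ b c * scaledNormal b c j +
        segmentMean ψ c a * scaledNormal c a j := by
  have hd : Continuous (fderiv ℝ ψ) := hψ.continuous_fderiv one_ne_zero
  have hdec : ∀ v : Plane, v = v 0 • EuclideanSpace.single 0 1 + v 1 • EuclideanSpace.single 1 1 := by
    intro v
    ext i
    fin_cases i <;> simp
  have hint : ∀ v : Plane, IntegrableOn
      (fun p : ℝ × ℝ => fderiv ℝ ψ (c + p.1 • (a - c) + p.2 • (b - c)) v) stdTriangle := fun v =>
    (by fun_prop : Continuous _).continuousOn.integrableOn_compact isCompact_stdTriangle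
  have hlin : ∀ v : Plane,
      ∫ p in stdTriangle, fderiv ℝ ψ (c + p.1 • (a - c) + p.2 • (b - c)) v =
      v 0 * (∫ p in stdTriangle, fderiv ℝ ψ (c + p.1 • (a - c) + p.2 • (b - c))
        (EuclideanSpace.single 0 1)) +
      v 1 * (∫ p in stdTriangle, fderiv ℝ ψ (c + p.1 • (a - c) + p.2 • (b - c))
        (EuclideanSpace.single 1 1)) := by
    intro v
    rw [← integral_const_mul, ← integral_const_mul, ← integral_add ((hint _).const_mul _)
      ((hint _).const_mul _)]
    congr 1
    ext p
    conv_lhs => rw [hdec v]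
    simp
  -- After `hlin`, `e1` and `e2` are a linear system for the integrals of the two partial
  -- derivatives. Its determinant is `orient c a b` up to sign, and the final combinations are
  -- Cramer's rule.
  have e1 := setIntegral_stdTriangle_fderiv hψ c a b
  have e2 := setIntegral_stdTriangle_fderiv' hψ c a b
  rw [hlin] at e1 e2
  rw [setIntegral_triangle h]
  simp only [PiLp.sub_apply] at e1 e2
  fin_cases j
  · simp only [orient, scaledNormal, Fin.zero_eta, Matrix.cons_val_zero, PiLp.toLp_apply]
    linear_combination (b 1 - c 1) * e2 - (a 1 - c 1) * e1
  · simp only [orient, scaledNormal, Fin.mk_one, Matrix.cons_val_one, PiLp.toLp_apply,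
      Matrix.cons_val_zero]
    linear_combination (a 0 - c 0) * e1 - (b 0 - c 0) * e2

/-! ### Finite almost disjoint unions of closed sets -/

/-- A common point cannot be interior to both sets, so it lies on one of the two null frontiers. -/
lemma aedisjoint_of_disjoint_interior {A B : Set Plane} (hA : IsClosed A) (hB : IsClosed B)
    (hA0 : volume (frontier A) = 0) (hB0 : volume (frontier B) = 0)
    (h : Disjoint (interior A) (interior B)) : AEDisjoint volume A B := by
  refine measure_mono_null ?_ (measure_union_null hA0 hB0)
  rintro x ⟨hxA, hxB⟩
  rw [hA.frontier_eq, hB.frontier_eq]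
  by_cases hx : x ∈ interior A
  · exact Or.inr ⟨hxB, fun hx' => Set.disjoint_left.1 h hx hx'⟩
  · exact Or.inl ⟨hxA, hx⟩

lemma volume_frontier_iUnion_eq_zero {ι : Type*} [Finite ι] {A : ι → Set Plane}
    (hA : ∀ i, IsClosed (A i)) (hA0 : ∀ i, volume (frontier (A i)) = 0) :
    volume (frontier (⋃ i, A i)) = 0 := by
  refine measure_mono_null ?_ (measure_iUnion_null hA0)
  rw [(isClosed_iUnion_of_finite hA).frontier_eq]
  rintro x ⟨hx, hx'⟩
  obtain ⟨i, hi⟩ := Set.mem_iUnion.1 hx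
  refine Set.mem_iUnion.2 ⟨i, ?_⟩
  rw [(hA i).frontier_eq]
  exact ⟨hi, fun h => hx' (interior_mono (Set.subset_iUnion A i) h)⟩

lemma setIntegral_iUnion_of_aedisjoint {ι E : Type*} [Fintype ι] [NormedAddCommGroup E]
    [NormedSpace ℝ E] {A : ι → Set Plane} (hA : ∀ i, IsClosed (A i))
    (hd : Pairwise (Function.onFun (AEDisjoint volume) A)) {f : Plane → E}
    (hf : IntegrableOn f (⋃ i, A i)) : ∫ x in ⋃ i, A i, f x = ∑ i, ∫ x in A i, f x := by
  rw [integral_iUnion_ae (fun i => (hA i).measurableSet.nullMeasurableSet) hd hf, tsum_fintype]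

/-! ### Geometry of a cell and the divergence theorem on it -/

namespace PolygonalCell

variable (P : PolygonalCell)

/-- The triangle that joins the center of the cell to edge `k`. -/
def fan (k : Fin P.nv) : Set Plane := convexHull ℝ {P.center, P.src k, P.tgt k}

lemma region_eq_iUnion_fan : P.region = ⋃ k, P.fan k := rfl

lemma isCompact_fan (k : Fin P.nv) : IsCompact (P.fan k) :=
  (Set.toFinite _).isCompact_convexHull ℝ

lemma volume_frontier_fan (k : Fin P.nv) : volume (frontier (P.fan k)) = 0 :=
  (convex_convexHull ℝ _).addHaar_frontier volume

lemma isCompact_region : IsCompact P.region := isCompact_iUnion P.isCompact_fan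

lemma measurableSet_region : MeasurableSet P.region := P.isCompact_region.measurableSet

lemma volume_frontier_region : volume (frontier P.region) = 0 :=
  volume_frontier_iUnion_eq_zero (fun k => (P.isCompact_fan k).isClosed) P.volume_frontier_fan

lemma aedisjoint_fan : Pairwise (Function.onFun (AEDisjoint volume) P.fan) := fun k l hkl =>
  aedisjoint_of_disjoint_interior (P.isCompact_fan k).isClosed (P.isCompact_fan l).isClosed
    (P.volume_frontier_fan k) (P.volume_frontier_fan l) (P.fan_disjoint k l hkl)

lemma center_mem_fan (k : Fin P.nv) : P.center ∈ P.fan k := subset_convexHull ℝ _ (by simp)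

/-- An edge of the cell. -/
def firstEdge : Fin P.nv := ⟨0, by have := P.three_le_nv; omega⟩

lemma center_mem_region : P.center ∈ P.region :=
  Set.mem_iUnion.2 ⟨P.firstEdge, P.center_mem_fan _⟩

lemma edge_subset_region (k : Fin P.nv) : segment ℝ (P.src k) (P.tgt k) ⊆ P.region :=
  (segment_subset_convexHull (by simp) (by simp)).trans (Set.subset_iUnion P.fan k)

lemma src_mem_region (k : Fin P.nv) : P.src k ∈ P.region :=
  P.edge_subset_region k (left_mem_segment ℝ _ _)

lemma isPreconnected_region : IsPreconnected P.region :=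
  isPreconnected_iUnion ⟨P.center, Set.mem_iInter.2 P.center_mem_fan⟩
    fun _ => (convex_convexHull ℝ _).isPreconnected

lemma dist_le_diam {x y : Plane} (hx : x ∈ P.region) (hy : y ∈ P.region) : dist x y ≤ P.diam :=
  Metric.dist_le_diam_of_mem P.isCompact_region.isBounded hx hy

lemma diam_nonneg : 0 ≤ P.diam := Metric.diam_nonneg

lemma diam_pos : 0 < P.diam := by
  have hne : P.center ≠ P.src P.firstEdge := by
    intro h
    have h1 := P.orient_pos P.firstEdge
    rw [h, orient] at h1
    simp [src] at h1
  exact (dist_pos.2 hne).trans_le (P.dist_le_diam P.center_mem_region (P.src_mem_region _))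

lemma area_pos {σ : ℝ} (hσ : 0 < σ) (h : P.ShapeRegular σ) : 0 < P.area := by
  obtain ⟨⟨c, hc⟩, -⟩ := h
  have h1 : 0 < volume (Metric.closedBall c (P.diam / σ)) :=
    Metric.measure_closedBall_pos _ _ (div_pos P.diam_pos hσ)
  exact ENNReal.toReal_pos (h1.trans_le (measure_mono hc)).ne'
    P.isCompact_region.measure_lt_top.ne

lemma area_le : P.area ≤ P.diam ^ 2 * volume.real (Metric.closedBall (0 : Plane) 1) := by
  have h : P.region ⊆ Metric.closedBall P.center P.diam := fun x hx =>
    P.dist_le_diam hx P.center_mem_region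
  calc P.area ≤ volume.real (Metric.closedBall P.center P.diam) :=
        measureReal_mono h (isCompact_closedBall _ _).measure_lt_top.ne
    _ = _ := by
        rw [Measure.addHaar_real_closedBall' volume _ P.diam_nonneg]
        simp

/-- The boundary polygon is closed: the edge vectors telescope around the cycle of vertices. -/
lemma sum_scaledNormal (j : Fin 2) : ∑ k, scaledNormal (P.src k) (P.tgt k) j = 0 := by
  have h : ∀ i, ∑ k, (P.tgt k i - P.src k i) = 0 := fun i => by
    rw [Finset.sum_sub_distrib, sub_eq_zero]
    exact Equiv.sum_comp (finRotate P.nv) (fun k => P.vertex k i)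
  fin_cases j
  · simpa [scaledNormal] using h 1
  · have := h 0
    rw [← neg_eq_zero, ← Finset.sum_neg_distrib] at this
    simpa [scaledNormal] using this

/-- The divergence theorem on a cell. -/
lemma setIntegral_region_fderiv {ψ : Plane → ℝ} (hψ : ContDiff ℝ 1 ψ) (j : Fin 2) :
    ∫ x in P.region, fderiv ℝ ψ x (EuclideanSpace.single j 1) =
      ∑ k, segmentMean ψ (P.src k) (P.tgt k) * scaledNormal (P.src k) (P.tgt k) j := by
  have hd : Continuous (fderiv ℝ ψ) := hψ.continuous_fderiv one_ne_zero
  have hc : Continuous fun x => fderiv ℝ ψ x (EuclideanSpace.single j 1) := by fun_prop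
  rw [region_eq_iUnion_fan, setIntegral_iUnion_of_aedisjoint
    (fun k => (P.isCompact_fan k).isClosed) P.aedisjoint_fan
    (hc.continuousOn.integrableOn_compact P.isCompact_region)]
  -- The two sides of a fan triangle at the center contribute a function of `src k` minus the same
  -- function of `tgt k`. This cancels in the cyclic sum over the edges.
  have h : ∀ k, ∫ x in P.fan k, fderiv ℝ ψ x (EuclideanSpace.single j 1) =
      segmentMean ψ (P.src k) (P.tgt k) * scaledNormal (P.src k) (P.tgt k) j +
      (segmentMean ψ P.center (P.src k) * scaledNormal P.center (P.src k) j -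
        segmentMean ψ P.center (P.tgt k) * scaledNormal P.center (P.tgt k) j) := fun k => by
    rw [fan, setIntegral_triangle_fderiv hψ
      (c := P.center) (a := P.src k) (b := P.tgt k) (P.orient_pos k), segmentMean_comm ψ (P.tgt k),
      scaledNormal_swap P.center (P.tgt k)]
    simp only [PiLp.neg_apply]
    ring
  simp only [h, Finset.sum_add_distrib, Finset.sum_sub_distrib]
  rw [add_eq_left, sub_eq_zero]
  exact (Equiv.sum_comp (finRotate P.nv) (fun k =>
    segmentMean ψ P.center (P.vertex k) * scaledNormal P.center (P.vertex k) j)).symm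

/-! ### Oscillation over a cell -/

/-- The triangular subcell `a`. -/
def subcell (a : Fin P.nsub) : Set Plane := convexHull ℝ (Set.range (P.subVertex a))

lemma iUnion_subcell : ⋃ a, P.subcell a = P.region := P.sub_cover

lemma isClosed_subcell (a : Fin P.nsub) : IsClosed (P.subcell a) :=
  ((Set.finite_range _).isCompact_convexHull ℝ).isClosed

lemma subcell_subset_region (a : Fin P.nsub) : P.subcell a ⊆ P.region := by
  rw [← iUnion_subcell]
  exact Set.subset_iUnion P.subcell a

lemma subcell_subset_subBall (a : Fin P.nsub) : P.subcell a ⊆ P.subBall a := P.sub_subset_ball a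

lemma region_subset_patch : P.region ⊆ P.patch := by
  rw [← iUnion_subcell]
  exact Set.iUnion_mono P.subcell_subset_subBall

lemma subcell_nonempty (a : Fin P.nsub) : (P.subcell a).Nonempty :=
  (Set.range_nonempty _).convexHull

/-- Two subcells are adjacent if they meet. -/
def subcellGraph : SimpleGraph (Fin P.nsub) where
  Adj a b := a ≠ b ∧ (P.subcell a ∩ P.subcell b).Nonempty
  symm := ⟨fun _ _ h => ⟨h.1.symm, Set.inter_comm _ _ ▸ h.2⟩⟩
  loopless := ⟨fun _ h => h.1 rfl⟩

/-- Otherwise the subcells reachable from `a` and the remaining ones would form two nonempty closed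
sets that cover the connected region. These must meet, and a common point makes a reachable subcell
adjacent to an unreachable one. -/
lemma subcellGraph_preconnected : P.subcellGraph.Preconnected := by
  intro a b
  by_contra hab
  let s : Set Plane := ⋃ c : {c // P.subcellGraph.Reachable a c}, P.subcell c
  let t : Set Plane := ⋃ c : {c // ¬ P.subcellGraph.Reachable a c}, P.subcell c
  have hs : IsClosed s := isClosed_iUnion_of_finite fun c => P.isClosed_subcell c
  have ht : IsClosed t := isClosed_iUnion_of_finite fun c => P.isClosed_subcell c
  have hst : P.region ⊆ s ∪ t := by
    rw [← iUnion_subcell]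
    refine Set.iUnion_subset fun c => ?_
    by_cases hc : P.subcellGraph.Reachable a c
    · exact fun x hx => Or.inl (Set.mem_iUnion.2 ⟨⟨c, hc⟩, hx⟩)
    · exact fun x hx => Or.inr (Set.mem_iUnion.2 ⟨⟨c, hc⟩, hx⟩)
  obtain ⟨x, hx⟩ := P.subcell_nonempty a
  obtain ⟨y, hy⟩ := P.subcell_nonempty b
  obtain ⟨z, -, hzs, hzt⟩ := isPreconnected_closed_iff.1 P.isPreconnected_region s t hs ht hst
    ⟨x, P.subcell_subset_region a hx, Set.mem_iUnion.2 ⟨⟨a, .refl a⟩, hx⟩⟩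
    ⟨y, P.subcell_subset_region b hy, Set.mem_iUnion.2 ⟨⟨b, hab⟩, hy⟩⟩
  obtain ⟨⟨c, hc⟩, hzc⟩ := Set.mem_iUnion.1 hzs
  obtain ⟨⟨d, hd⟩, hzd⟩ := Set.mem_iUnion.1 hzt
  refine hd (hc.trans (SimpleGraph.Adj.reachable ⟨?_, z, hzc, hzd⟩))
  rintro rfl
  exact hd hc

/-- The sum over the subcells of the largest deviation of `u` from its value at the center. -/
noncomputable def deviation {E : Type*} [NormedAddCommGroup E] (u : Plane → E) (D : Set Plane) :
    ℝ≥0∞ := ∑ a, ⨆ x ∈ P.subBall a ∩ D, ‖u x - u (P.subCenter a)‖ₑ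

/-- Values are compared along a path of meeting subcells, from center to common point to next
center. Each subcell on the path is entered once and left once, hence the factor 2. -/
lemma edist_le_deviation {E : Type*} [NormedAddCommGroup E] (u : Plane → E) {D : Set Plane}
    (hD : P.region ⊆ D) {x y : Plane} (hx : x ∈ P.patch ∩ D) (hy : y ∈ P.patch ∩ D) :
    edist (u x) (u y) ≤ 2 * P.deviation u D := by
  set v : Fin P.nsub → ℝ≥0∞ := fun a => ⨆ x ∈ P.subBall a ∩ D, ‖u x - u (P.subCenter a)‖ₑ
  set c : Fin P.nsub → E := fun a => u (P.subCenter a) with hc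
  have hle : ∀ a, ∀ x ∈ P.subBall a ∩ D, edist (u x) (c a) ≤ v a := fun a x hx => by
    rw [edist_eq_enorm_sub]
    exact le_iSup₂ (f := fun x _ => ‖u x - u (P.subCenter a)‖ₑ) x hx
  -- The extra terms `v a` and `v b` are reserved for the distances from `x` and `y` to the centers
  -- at the two ends. With them the induction closes with the factor 2 on every vertex.
  have hwalk : ∀ a b (p : P.subcellGraph.Walk a b),
      v a + edist (c a) (c b) + v b ≤ 2 * (p.support.map v).sum := by
    intro a b p
    induction p with
    | nil => simp [two_mul]
    | @cons a d b h p ih =>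
      have ⟨z, hz⟩ := h.2
      have hza := hz.1
      have hzd := hz.2
      have h1 := hle a z ⟨P.subcell_subset_subBall a hza, hD (P.subcell_subset_region a hza)⟩
      have h2 := hle d z ⟨P.subcell_subset_subBall d hzd, hD (P.subcell_subset_region d hzd)⟩
      have h3 : edist (c a) (c b) ≤ v a + v d + edist (c d) (c b) :=
        (edist_triangle4 _ (u z) _ _).trans (by rw [edist_comm (c a)]; gcongr)
      rw [SimpleGraph.Walk.support_cons, List.map_cons, List.sum_cons, mul_add]
      calc v a + edist (c a) (c b) + v b
          ≤ v a + (v a + v d + edist (c d) (c b)) + v b := by gcongr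
        _ = 2 * v a + (v d + edist (c d) (c b) + v b) := by ring
        _ ≤ _ := by gcongr
  obtain ⟨a, ha⟩ := Set.mem_iUnion.1 hx.1
  obtain ⟨b, hb⟩ := Set.mem_iUnion.1 hy.1
  obtain ⟨p, hp⟩ := (P.subcellGraph_preconnected a b).exists_isPath
  -- A path has no repeated vertex, so its sum is part of the sum over all subcells; a general walk
  -- would not do.
  have hsum : (p.support.map v).sum ≤ P.deviation u D := by
    rw [← List.sum_toFinset v hp.support_nodup]
    exact Finset.sum_le_sum_of_subset (Finset.subset_univ _)
  calc edist (u x) (u y) ≤ edist (u x) (c a) + edist (c a) (c b) + edist (c b) (u y) :=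
        edist_triangle4 _ _ _ _
    _ ≤ v a + edist (c a) (c b) + v b := by
        rw [edist_comm (c b)]
        gcongr
        · exact hle a x ⟨ha, hx.2⟩
        · exact hle b y ⟨hb, hy.2⟩
    _ ≤ 2 * (p.support.map v).sum := hwalk a b p
    _ ≤ _ := by gcongr

end PolygonalCell

/-! ### Lipschitz functions: integrability, derivatives, averages over a cell -/

/-- A Lipschitz function of an integrable function is integrable on a set of finite measure. -/
lemma LipschitzWith.integrableOn_comp {X E E' : Type*} [MeasurableSpace X] {μ : Measure X}
    [NormedAddCommGroup E] [NormedAddCommGroup E'] {g : E → E'} {K : NNReal}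
    (hg : LipschitzWith K g) {f : X → E} {s : Set X} (hf : IntegrableOn f s μ) (hs : μ s ≠ ⊤) :
    IntegrableOn (fun x => g (f x)) s μ := by
  have hfin : IsFiniteMeasure (μ.restrict s) := ⟨by simpa using hs.lt_top⟩
  refine Integrable.mono' ((integrable_const ‖g 0‖).add (hf.norm.const_mul (K : ℝ)))
    (hg.continuous.comp_aestronglyMeasurable hf.aestronglyMeasurable) (.of_forall fun x => ?_)
  have h := hg.norm_sub_le (f x) 0
  rw [sub_zero] at h
  calc ‖g (f x)‖ ≤ ‖g 0‖ + ‖g (f x) - g 0‖ := by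
        simpa using norm_add_le (g 0) (g (f x) - g 0)
    _ ≤ _ := by simp only [Pi.add_apply]; gcongr

lemma norm_fderiv_single_le {ψ : Plane → ℝ} {M : NNReal} (hψ : LipschitzWith M ψ) (x : Plane)
    (j : Fin 2) : ‖fderiv ℝ ψ x (EuclideanSpace.single j 1)‖ ≤ M := by
  have h := (fderiv ℝ ψ x).le_opNorm (EuclideanSpace.single j 1)
  have h' : ‖(EuclideanSpace.single j 1 : Plane)‖ = 1 := by simp
  rw [h', mul_one] at h
  exact h.trans (norm_fderiv_le_of_lipschitz ℝ hψ)

/-- The area of the unit disk. -/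
noncomputable def diskArea : ℝ := volume.real (Metric.closedBall (0 : Plane) 1)

lemma diskArea_nonneg : 0 ≤ diskArea := measureReal_nonneg

namespace PolygonalCell

variable (P : PolygonalCell)

/-- All values on the cell lie in a closed ball, which is convex and so contains their average. The
inner ball of a shape-regular cell enters through the positivity of the area. -/
lemma abs_average_sub_le {ψ : Plane → ℝ} {M : NNReal} (hψ : LipschitzWith M ψ) {σ : ℝ}
    (hσ : 0 < σ) (h : P.ShapeRegular σ) {y : Plane} (hy : y ∈ P.region) :
    |(⨍ x in P.region, ψ x) - ψ y| ≤ M * P.diam := by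
  have hmem := Convex.set_average_mem (μ := volume) (t := P.region) (f := ψ)
    (convex_closedBall (ψ y) (M * P.diam)) Metric.isClosed_closedBall
    (fun h0 => (P.area_pos hσ h).ne' (by simp [area, measureReal_def, h0]))
    P.isCompact_region.measure_lt_top.ne
    (ae_restrict_of_forall_mem P.measurableSet_region fun x hx => ?_)
    (hψ.continuous.continuousOn.integrableOn_compact P.isCompact_region)
  · simpa [Real.dist_eq] using hmem
  · exact (hψ.dist_le_mul x y).trans (by gcongr; exact P.dist_le_diam hx hy)

lemma abs_average_sub_segmentMean_le {ψ : Plane → ℝ} {M : NNReal} (hψ : LipschitzWith M ψ) {σ : ℝ}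
    (hσ : 0 < σ) (h : P.ShapeRegular σ) (k : Fin P.nv) :
    |(⨍ x in P.region, ψ x) - segmentMean ψ (P.src k) (P.tgt k)| ≤ M * P.diam := by
  have hc := hψ.continuous
  have heq : (⨍ x in P.region, ψ x) - segmentMean ψ (P.src k) (P.tgt k) =
      ∫ s in (0 : ℝ)..1, ((⨍ x in P.region, ψ x) - ψ (P.src k + s • (P.tgt k - P.src k))) := by
    rw [intervalIntegral.integral_sub (by simp)
      ((by fun_prop : Continuous _).intervalIntegrable _ _)]
    simp [segmentMean]
  rw [heq]
  have := intervalIntegral.norm_integral_le_of_norm_le_const (a := 0) (b := 1) (C := M * P.diam)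
    (f := fun s : ℝ => (⨍ x in P.region, ψ x) - ψ (P.src k + s • (P.tgt k - P.src k))) ?_
  · simpa using this
  · intro s hs
    rw [Set.uIoc_of_le zero_le_one] at hs
    refine P.abs_average_sub_le hψ hσ h (P.edge_subset_region k ?_)
    rw [segment_eq_image']
    exact ⟨s, ⟨hs.1.le, hs.2⟩, rfl⟩

end PolygonalCell

/-! ### Sums over the cells and the edges of a mesh -/

namespace PolygonalMesh

variable {Ω : Set Plane} (M : PolygonalMesh Ω)

lemma isCompact_closure (M : PolygonalMesh Ω) : IsCompact (closure Ω) := by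
  rw [← M.cover]
  exact isCompact_iUnion fun i => (M.cell i).isCompact_region

lemma region_subset (i : Fin M.ncell) : (M.cell i).region ⊆ closure Ω := by
  rw [← M.cover]
  exact Set.subset_iUnion (fun i => (M.cell i).region) i

lemma diam_le_size (i : Fin M.ncell) : (M.cell i).diam ≤ M.size :=
  le_ciSup (f := fun i => (M.cell i).diam) (Set.finite_range _).bddAbove i

lemma size_nonneg : 0 ≤ M.size := Real.iSup_nonneg fun i => (M.cell i).diam_nonneg

lemma area_le (i : Fin M.ncell) : (M.cell i).area ≤ M.size ^ 2 * diskArea :=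
  (M.cell i).area_le.trans (by
    rw [diskArea]
    gcongr
    · exact (M.cell i).diam_nonneg
    · exact M.diam_le_size i)

lemma setIntegral_closure {E : Type*} [NormedAddCommGroup E] [NormedSpace ℝ E] {f : Plane → E}
    (hf : IntegrableOn f (closure Ω)) :
    ∫ x in closure Ω, f x = ∑ i, ∫ x in (M.cell i).region, f x := by
  rw [← M.cover] at hf ⊢
  exact setIntegral_iUnion_of_aedisjoint (fun i => (M.cell i).isCompact_region.isClosed)
    (fun i j hij => aedisjoint_of_disjoint_interior (M.cell i).isCompact_region.isClosed
      (M.cell j).isCompact_region.isClosed (M.cell i).volume_frontier_region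
      (M.cell j).volume_frontier_region (M.cell_disjoint i j hij)) hf

/-- On the patch of cell `i`, the function `u` oscillates by at most `W i`. -/
structure OscBound {E : Type*} [NormedAddCommGroup E] (u : Plane → E) (W : Fin M.ncell → ℝ) :
    Prop where
  nonneg : ∀ i, 0 ≤ W i
  le : ∀ i, ∀ x ∈ (M.cell i).patch ∩ closure Ω, ∀ y ∈ (M.cell i).patch ∩ closure Ω,
    ‖u x - u y‖ ≤ W i

variable {M}

lemma mem_patch_inter {i : Fin M.ncell} {x : Plane} (hx : x ∈ (M.cell i).region) :
    x ∈ (M.cell i).patch ∩ closure Ω :=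
  ⟨(M.cell i).region_subset_patch hx, M.region_subset i hx⟩

lemma OscBound.le_region {E : Type*} [NormedAddCommGroup E] {u : Plane → E}
    {W : Fin M.ncell → ℝ} (hW : M.OscBound u W) {i : Fin M.ncell} {x y : Plane}
    (hx : x ∈ (M.cell i).region) (hy : y ∈ (M.cell i).region) : ‖u x - u y‖ ≤ W i :=
  hW.le i x (mem_patch_inter hx) y (mem_patch_inter hy)

/-- A sum of local errors, each bounded by the area times the oscillation. -/
lemma norm_sum_setIntegral_le {E : Type*} [NormedAddCommGroup E] [NormedSpace ℝ E]
    {W : Fin M.ncell → ℝ} (hW0 : ∀ i, 0 ≤ W i) {B : ℝ} (hB : 0 ≤ B)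
    (f : Fin M.ncell → Plane → E) (hf : ∀ i, ∀ x ∈ (M.cell i).region, ‖f i x‖ ≤ B * W i) :
    ‖∑ i, ∫ x in (M.cell i).region, f i x‖ ≤ B * diskArea * (M.size ^ 2 * ∑ i, W i) := by
  calc ‖∑ i, ∫ x in (M.cell i).region, f i x‖
      ≤ ∑ i, ‖∫ x in (M.cell i).region, f i x‖ := norm_sum_le _ _
    _ ≤ ∑ i, B * W i * (M.size ^ 2 * diskArea) := by
        refine Finset.sum_le_sum fun i _ => ?_
        have hb : 0 ≤ B * W i := mul_nonneg hB (hW0 i)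
        exact (norm_setIntegral_le_of_norm_le_const
          (M.cell i).isCompact_region.measure_lt_top (hf i)).trans
          (mul_le_mul_of_nonneg_left (M.area_le i) hb)
    _ = _ := by
        simp only [Finset.mul_sum]
        exact Finset.sum_congr rfl fun i _ => by ring

/-- On each cell the difference is the integral of `ψ` times the deviation of `u` from its average,
and the average is within `W i` of every value of `u` on the cell. -/
lemma OscBound.norm_sum_average_sub_le {E : Type*} [NormedAddCommGroup E] [NormedSpace ℝ E]
    [CompleteSpace E] {u : Plane → E} {W : Fin M.ncell → ℝ} (hW : M.OscBound u W)
    (hu : IntegrableOn u (closure Ω)) {σ : ℝ} (hσ : 0 < σ)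
    (hM : ∀ i, (M.cell i).ShapeRegular σ) {ψ : Plane → ℝ} (hψ : Continuous ψ) {B : ℝ}
    (hB : 0 ≤ B) (hψB : ∀ x, |ψ x| ≤ B) :
    ‖∑ i, (∫ x in (M.cell i).region, ψ x) • (⨍ x in (M.cell i).region, u x) -
      ∫ x in closure Ω, ψ x • u x‖ ≤ B * diskArea * (M.size ^ 2 * ∑ i, W i) := by
  have hint : IntegrableOn (fun x => ψ x • u x) (closure Ω) :=
    hu.continuousOn_smul hψ.continuousOn M.isCompact_closure
  rw [M.setIntegral_closure hint, ← Finset.sum_sub_distrib]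
  have heq : ∀ i, (∫ x in (M.cell i).region, ψ x) • (⨍ x in (M.cell i).region, u x) -
      ∫ x in (M.cell i).region, ψ x • u x =
      ∫ x in (M.cell i).region, ψ x • ((⨍ y in (M.cell i).region, u y) - u x) := fun i => by
    have hψi : IntegrableOn ψ (M.cell i).region :=
      hψ.continuousOn.integrableOn_compact (M.cell i).isCompact_region
    simp only [smul_sub]
    rw [integral_sub (hψi.smul_const _) (hint.mono_set (M.region_subset i)), integral_smul_const]
  simp only [heq]
  refine norm_sum_setIntegral_le hW.nonneg hB _ fun i x hx => ?_
  rw [norm_smul]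
  refine mul_le_mul (hψB x) ?_ (norm_nonneg _) hB
  have hmem := Convex.set_average_mem (μ := volume) (t := (M.cell i).region) (f := u)
    (convex_closedBall (u x) (W i)) Metric.isClosed_closedBall
    (fun h0 => ((M.cell i).area_pos hσ (hM i)).ne' (by
      simp [PolygonalCell.area, measureReal_def, h0]))
    (M.cell i).isCompact_region.measure_lt_top.ne
    (ae_restrict_of_forall_mem (M.cell i).measurableSet_region fun y hy => ?_)
    (hu.mono_set (M.region_subset i))
  · simpa [dist_eq_norm] using hmem
  · rw [Metric.mem_closedBall, dist_eq_norm]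
    exact hW.le_region hy hx

variable (M)

/-- The opposite edge of an interior edge; a boundary edge is its own opposite. -/
def reverse (e : M.Edge) : M.Edge := (M.opp e).getD e

variable {M}

lemma reverse_eq {e f : M.Edge} (h : M.opp e = some f) : M.reverse e = f := by simp [reverse, h]

lemma reverse_eq_self {e : M.Edge} (h : M.opp e = none) : M.reverse e = e := by simp [reverse, h]

lemma reverse_involutive : Function.Involutive M.reverse := by
  intro e
  rcases h : M.opp e with _ | f
  · rw [reverse_eq_self h, reverse_eq_self h]
  · rw [reverse_eq h, reverse_eq (M.opp_symm e f h)]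

lemma sum_reverse {E : Type*} [AddCommMonoid E] (f : M.Edge → E) :
    ∑ e, f (M.reverse e) = ∑ e, f e :=
  Equiv.sum_comp reverse_involutive.toPerm f

lemma edgeLength_reverse (e : M.Edge) :
    (M.cell (M.reverse e).1).edgeLength (M.reverse e).2 = (M.cell e.1).edgeLength e.2 := by
  rcases h : M.opp e with _ | f
  · rw [reverse_eq_self h]
  · rw [reverse_eq h, PolygonalCell.edgeLength, M.opp_src e f h, M.opp_tgt e f h, dist_comm]
    rfl

lemma edgeLength_nonneg (e : M.Edge) : 0 ≤ (M.cell e.1).edgeLength e.2 := dist_nonneg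

/-- Opposite edges have equal length, so reindexing by `reverse` moves the neighbour's oscillation
to its own cell. This gives the factor 2, and the perimeter bound does the rest. -/
lemma sum_edgeLength_mul_le {σ : ℝ} (hσ : 0 < σ) (hM : ∀ i, (M.cell i).ShapeRegular σ)
    {W : Fin M.ncell → ℝ} (hW0 : ∀ i, 0 ≤ W i) :
    ∑ e : M.Edge, (M.cell e.1).edgeLength e.2 * (W e.1 + W (M.reverse e).1) ≤
      2 * σ * M.size * ∑ i, W i := by
  have h1 : ∑ e : M.Edge, (M.cell e.1).edgeLength e.2 * W (M.reverse e).1 =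
      ∑ e : M.Edge, (M.cell e.1).edgeLength e.2 * W e.1 := by
    rw [← sum_reverse fun e : M.Edge => (M.cell e.1).edgeLength e.2 * W e.1]
    exact Finset.sum_congr rfl fun e _ => by rw [edgeLength_reverse]
  have h2 : ∑ e : M.Edge, (M.cell e.1).edgeLength e.2 * W e.1 ≤ σ * M.size * ∑ i, W i := by
    rw [Fintype.sum_sigma, Finset.mul_sum]
    refine Finset.sum_le_sum fun i _ => ?_
    refine (Finset.sum_mul Finset.univ (M.cell i).edgeLength (W i)).symm.trans_le ?_
    refine mul_le_mul_of_nonneg_right ?_ (hW0 i)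
    exact (hM i).2.trans (mul_le_mul_of_nonneg_left (M.diam_le_size i) hσ.le)
  simp only [mul_add, Finset.sum_add_distrib, h1]
  linarith

/-- The deviation from the value at the center of a cell, over the patches on both sides of an
edge. -/
lemma OscBound.le_of_opp {E : Type*} [NormedAddCommGroup E] {u : Plane → E}
    {W : Fin M.ncell → ℝ} (hW : M.OscBound u W) {e f : M.Edge} (h : M.opp e = some f) {x : Plane}
    (hx : x ∈ ((M.cell e.1).patch ∪ (M.cell f.1).patch) ∩ closure Ω) :
    ‖u x - u (M.cell e.1).center‖ ≤ W e.1 + W f.1 := by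
  have hc := mem_patch_inter (M.cell e.1).center_mem_region
  rcases hx with ⟨hx | hx, hxΩ⟩
  · exact (hW.le _ x ⟨hx, hxΩ⟩ _ hc).trans (le_add_of_nonneg_right (hW.nonneg _))
  -- The two patches are linked by an endpoint of the common edge, which lies in both cells.
  · have hp := mem_patch_inter ((M.cell e.1).src_mem_region e.2)
    have hp' : (M.cell e.1).src e.2 ∈ (M.cell f.1).patch ∩ closure Ω := by
      rw [M.opp_src f e (M.opp_symm e f h)]
      exact mem_patch_inter ((M.cell f.1).edge_subset_region f.2 (right_mem_segment ℝ _ _))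
    calc ‖u x - u (M.cell e.1).center‖
        ≤ ‖u x - u ((M.cell e.1).src e.2)‖ +
          ‖u ((M.cell e.1).src e.2) - u (M.cell e.1).center‖ := norm_sub_le_norm_sub_add_norm_sub ..
      _ ≤ W f.1 + W e.1 := add_le_add (hW.le _ x ⟨hx, hxΩ⟩ _ hp') (hW.le _ _ hp _ hc)
      _ = _ := add_comm _ _

end PolygonalMesh

/-! ### Numerical fluxes and the consistency of the discrete divergence -/

namespace Scheme

variable {Ω : Set Plane} {T : EReal} {ν : ℕ} {S : Scheme Ω T ν}

/-- Only the values of the flux on `U` matter, so it may be replaced by a Lipschitz extension. -/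
lemma AdmissibleFlux.congr {F G : Fin 2 → State ν → State ν} {U : Set (State ν)} {L : ℝ}
    (h : S.AdmissibleFlux F U L) (hFG : ∀ j, Set.EqOn (F j) (G j) U) : S.AdmissibleFlux G U L where
  values := h.values
  const_mem := h.const_mem
  conservative := h.conservative
  consistent n e f hef c hc := by
    rw [h.consistent n e f hef c hc]
    exact Finset.sum_congr rfl fun j _ => by rw [hFG j hc]
  lipschitz := h.lipschitz

/-- Consistency identifies the exact flux with the numerical flux of the constant state at the
center of the cell, and Lipschitz continuity compares the two. The absolute value is there because
the sign of `L` is not prescribed. -/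
lemma AdmissibleFlux.norm_flux_sub_le {F : Fin 2 → State ν → State ν} {U : Set (State ν)} {L : ℝ}
    (h : S.AdmissibleFlux F U L) (n : ℕ) {u : Plane → State ν} (hu : u ∈ S.space)
    {W : Fin S.mesh.ncell → ℝ} (hW : S.mesh.OscBound u W) {e f : S.mesh.Edge}
    (hef : S.mesh.opp e = some f) :
    ‖S.flux n e u - ∑ j, S.mesh.normal e j • F j (u (S.mesh.cell e.1).center)‖ ≤
      |L| * ((S.mesh.cell e.1).edgeLength e.2 * (W e.1 + W f.1)) := by
  have hc : u (S.mesh.cell e.1).center ∈ U :=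
    h.values u hu _ (S.mesh.region_subset _ (S.mesh.cell e.1).center_mem_region)
  rw [← h.consistent n e f hef _ hc]
  refine (h.lipschitz n e f hef u hu _ (h.const_mem _ hc) _ fun x hx =>
    hW.le_of_opp hef hx).trans ?_
  rw [mul_assoc]
  exact mul_le_mul_of_nonneg_right (le_abs_self L) (mul_nonneg (S.mesh.edgeLength_nonneg e)
    (add_nonneg (hW.nonneg _) (hW.nonneg _)))

/-- Conservation: the interior fluxes cancel in a sum with weights attached to the edges. -/
lemma AdmissibleFlux.sum_smul_flux_eq_zero {F : Fin 2 → State ν → State ν} {U : Set (State ν)}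
    {L : ℝ} (h : S.AdmissibleFlux F U L) (n : ℕ) {u : Plane → State ν} (hu : u ∈ S.space)
    (w : S.mesh.Edge → ℝ) (hw : ∀ e, w (S.mesh.reverse e) = w e)
    (hw0 : ∀ e, S.mesh.opp e = none → w e = 0) :
    ∑ e, w e • S.flux n e u = 0 := by
  -- Passing to the opposite edge keeps the weight and reverses the flux. A boundary edge stays
  -- fixed, but its weight is zero.
  have h1 : ∑ e, w e • S.flux n e u = -∑ e, w e • S.flux n e u := by
    conv_lhs => rw [← PolygonalMesh.sum_reverse]
    rw [← Finset.sum_neg_distrib]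
    refine Finset.sum_congr rfl fun e _ => ?_
    rw [hw]
    rcases hef : S.mesh.opp e with _ | f
    · simp [hw0 e hef]
    · rw [PolygonalMesh.reverse_eq hef,
        eq_neg_of_add_eq_zero_right (h.conservative n e f hef u hu), smul_neg]
  have h2 := add_eq_zero_iff_eq_neg.2 h1
  rw [← two_smul ℝ] at h2
  exact (smul_eq_zero.1 h2).resolve_left two_ne_zero

/-- Consistency of the discrete divergence, tested with a smooth function `ψ` that vanishes on all
cells at the boundary. -/
lemma AdmissibleFlux.norm_sum_average_smul_flux_add_le {F : Fin 2 → State ν → State ν}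
    {U : Set (State ν)} {L : ℝ} (h : S.AdmissibleFlux F U L) {K : NNReal}
    (hF : ∀ j, LipschitzWith K (F j)) {σ : ℝ} (hσ : 0 < σ)
    (hσS : ∀ i, (S.mesh.cell i).ShapeRegular σ) (n : ℕ) {u : Plane → State ν} (hu : u ∈ S.space)
    (hui : IntegrableOn u (closure Ω)) {W : Fin S.mesh.ncell → ℝ} (hW : S.mesh.OscBound u W)
    {ψ : Plane → ℝ} (hψ : ContDiff ℝ 1 ψ) {M : NNReal} (hM : LipschitzWith M ψ)
    (hψ0 : ∀ i, ((S.mesh.cell i).region ∩ frontier Ω).Nonempty →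
      ∀ x ∈ (S.mesh.cell i).region, ψ x = 0) :
    ‖∑ i, (⨍ x in (S.mesh.cell i).region, ψ x) • ∑ k, S.flux n ⟨i, k⟩ u +
      ∫ x in closure Ω, ∑ j, fderiv ℝ ψ x (EuclideanSpace.single j 1) • F j (u x)‖ ≤
      (2 * M * |L| * σ + 2 * M * K * diskArea) * (S.mesh.size ^ 2 * ∑ i, W i) := by
  set Φ : Fin S.mesh.ncell → ℝ := fun i => ⨍ x in (S.mesh.cell i).region, ψ x with hΦ
  set w : S.mesh.Edge → ℝ := fun e =>
    segmentMean ψ ((S.mesh.cell e.1).src e.2) ((S.mesh.cell e.1).tgt e.2) with hw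
  set c : Fin S.mesh.ncell → State ν := fun i => u (S.mesh.cell i).center with hc
  have hd : Continuous (fderiv ℝ ψ) := hψ.continuous_fderiv one_ne_zero
  have hbd : ∀ e, S.mesh.opp e = none →
      ∀ x ∈ (S.mesh.cell e.1).region, ψ x = 0 := fun e he =>
    hψ0 e.1 ⟨_, (S.mesh.cell e.1).src_mem_region e.2, S.mesh.boundary e he (left_mem_segment ℝ _ _)⟩
  have hw0 : ∀ e, S.mesh.opp e = none → w e = 0 := fun e he => by
    simp only [hw, segmentMean]
    rw [intervalIntegral.integral_congr (g := fun _ => 0)]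
    · simp
    · intro s hs
      rw [Set.uIcc_of_le zero_le_one] at hs
      refine hbd e he _ ((S.mesh.cell e.1).edge_subset_region e.2 ?_)
      rw [segment_eq_image']
      exact ⟨s, hs, rfl⟩
  have hΦ0 : ∀ e, S.mesh.opp e = none → Φ e.1 = 0 := fun e he => by
    simp only [hΦ]
    rw [setAverage_eq, setIntegral_eq_zero_of_forall_eq_zero (hbd e he), smul_zero]
  have hwr : ∀ e, w (S.mesh.reverse e) = w e := fun e => by
    rcases he : S.mesh.opp e with _ | f
    · rw [PolygonalMesh.reverse_eq_self he]
    · simp only [hw]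
      rw [PolygonalMesh.reverse_eq he, S.mesh.opp_src e f he, S.mesh.opp_tgt e f he,
        segmentMean_comm]
  -- This allows `Φ e.1` to be replaced by `Φ e.1 - w e`, which is O(h) while `Φ e.1` alone is not.
  have hcons := h.sum_smul_flux_eq_zero n hu w hwr hw0
  -- the part of the flux that deviates from the flux of a constant state
  have hdev : ‖∑ e : S.mesh.Edge, (Φ e.1 - w e) •
      (S.flux n e u - ∑ j, S.mesh.normal e j • F j (c e.1))‖ ≤
      2 * M * |L| * σ * (S.mesh.size ^ 2 * ∑ i, W i) := by
    have hMh : 0 ≤ M * S.mesh.size * |L| :=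
      mul_nonneg (mul_nonneg M.2 S.mesh.size_nonneg) (abs_nonneg L)
    calc _ ≤ ∑ e : S.mesh.Edge, M * S.mesh.size * |L| *
          ((S.mesh.cell e.1).edgeLength e.2 * (W e.1 + W (S.mesh.reverse e).1)) := by
          refine norm_sum_le_of_le _ fun e _ => ?_
          rcases he : S.mesh.opp e with _ | f
          · rw [hΦ0 e he, hw0 e he, sub_self, zero_smul, norm_zero]
            exact mul_nonneg hMh (mul_nonneg (S.mesh.edgeLength_nonneg e)
              (add_nonneg (hW.nonneg _) (hW.nonneg _)))
          · rw [norm_smul, mul_assoc _ |L|, PolygonalMesh.reverse_eq he]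
            refine mul_le_mul ?_ (h.norm_flux_sub_le n hu hW he) (norm_nonneg _)
              (mul_nonneg M.2 S.mesh.size_nonneg)
            exact ((S.mesh.cell e.1).abs_average_sub_segmentMean_le hM hσ (hσS _) e.2).trans
              (mul_le_mul_of_nonneg_left (S.mesh.diam_le_size _) M.2)
      -- The perimeter bound supplies the second factor h, completing the h² of the variation
      -- condition.
      _ ≤ M * S.mesh.size * |L| * (2 * σ * S.mesh.size * ∑ i, W i) := by
          rw [← Finset.mul_sum]
          exact mul_le_mul_of_nonneg_left
            (PolygonalMesh.sum_edgeLength_mul_le hσ hσS hW.nonneg) hMh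
      _ = _ := by ring
  -- the part of the flux of the constant states
  have hconst : ∀ i, ∑ k, (Φ i - w ⟨i, k⟩) • ∑ j, S.mesh.normal ⟨i, k⟩ j • F j (c i) =
      -∑ j, (∫ x in (S.mesh.cell i).region, fderiv ℝ ψ x (EuclideanSpace.single j 1)) •
        F j (c i) := fun i => by
    simp only [Finset.smul_sum, smul_smul]
    rw [Finset.sum_comm, ← Finset.sum_neg_distrib]
    refine Finset.sum_congr rfl fun j _ => ?_
    rw [← Finset.sum_smul, ← neg_smul, (S.mesh.cell i).setIntegral_region_fderiv hψ]
    congr 1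
    -- The vanishing sum of the normals removes `Φ i`; the edge means that are left form the
    -- boundary side of the divergence theorem.
    have h0 := (S.mesh.cell i).sum_scaledNormal j
    simp only [sub_mul, Finset.sum_sub_distrib, ← Finset.mul_sum]
    simp only [PolygonalMesh.normal, h0, hw]
    ring
  have hsum : ∑ i, Φ i • ∑ k, S.flux n ⟨i, k⟩ u =
      ∑ e : S.mesh.Edge, (Φ e.1 - w e) •
        (S.flux n e u - ∑ j, S.mesh.normal e j • F j (c e.1)) -
      ∑ i, ∑ j, (∫ x in (S.mesh.cell i).region, fderiv ℝ ψ x (EuclideanSpace.single j 1)) •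
        F j (c i) := by
    have h1 : ∑ i, Φ i • ∑ k, S.flux n ⟨i, k⟩ u = ∑ e : S.mesh.Edge, (Φ e.1 - w e) • S.flux n e u := by
      simp only [sub_smul, Finset.sum_sub_distrib, hcons, sub_zero, Finset.smul_sum]
      rw [Fintype.sum_sigma]
    simp only [smul_sub, Finset.sum_sub_distrib]
    rw [h1, Fintype.sum_sigma (f := fun e : S.mesh.Edge => (Φ e.1 - w e) •
      ∑ j, S.mesh.normal e j • F j (c e.1))]
    simp only [hconst, Finset.sum_neg_distrib]
    abel
  -- replacing the solution by constant states
  have hFu : ∀ j, IntegrableOn (fun x => fderiv ℝ ψ x (EuclideanSpace.single j 1) • F j (u x))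
      (closure Ω) := fun j =>
    ((hF j).integrableOn_comp hui S.mesh.isCompact_closure.measure_lt_top.ne).continuousOn_smul
      (by fun_prop) S.mesh.isCompact_closure
  have hrepl : ‖∑ i, ∫ x in (S.mesh.cell i).region,
      ∑ j, fderiv ℝ ψ x (EuclideanSpace.single j 1) • (F j (u x) - F j (c i))‖ ≤
      2 * M * K * diskArea * (S.mesh.size ^ 2 * ∑ i, W i) := by
    refine PolygonalMesh.norm_sum_setIntegral_le hW.nonneg (by positivity) _ fun i x hx => ?_
    refine (norm_sum_le_of_le _ (n := fun _ : Fin 2 => M * (K * W i)) fun j _ => ?_).trans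
      (le_of_eq ?_)
    · rw [norm_smul]
      refine mul_le_mul (norm_fderiv_single_le hM x j) ?_ (norm_nonneg _) M.2
      exact ((hF j).norm_sub_le _ _).trans (mul_le_mul_of_nonneg_left
        (hW.le_region hx (S.mesh.cell i).center_mem_region) K.2)
    · simp
      ring
  have hint : ∑ i, ∫ x in (S.mesh.cell i).region,
      ∑ j, fderiv ℝ ψ x (EuclideanSpace.single j 1) • (F j (u x) - F j (c i)) =
      (∫ x in closure Ω, ∑ j, fderiv ℝ ψ x (EuclideanSpace.single j 1) • F j (u x)) -
      ∑ i, ∑ j, (∫ x in (S.mesh.cell i).region, fderiv ℝ ψ x (EuclideanSpace.single j 1)) •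
        F j (c i) := by
    rw [S.mesh.setIntegral_closure (integrable_finsetSum _ fun j _ => hFu j),
      ← Finset.sum_sub_distrib]
    refine Finset.sum_congr rfl fun i _ => ?_
    have hψi : ∀ j, IntegrableOn (fun x => fderiv ℝ ψ x (EuclideanSpace.single j 1))
        (S.mesh.cell i).region := fun j =>
      (by fun_prop : Continuous _).continuousOn.integrableOn_compact (S.mesh.cell i).isCompact_region
    simp only [smul_sub, Finset.sum_sub_distrib]
    rw [integral_sub (integrable_finsetSum _ fun j _ => (hFu j).mono_set (S.mesh.region_subset i))
      (integrable_finsetSum _ fun j _ => (hψi j).smul_const _),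
      integral_finsetSum _ fun j _ => (hψi j).smul_const _]
    simp only [integral_smul_const]
  have hall : ∑ i, Φ i • ∑ k, S.flux n ⟨i, k⟩ u +
      ∫ x in closure Ω, ∑ j, fderiv ℝ ψ x (EuclideanSpace.single j 1) • F j (u x) =
      ∑ e : S.mesh.Edge, (Φ e.1 - w e) •
        (S.flux n e u - ∑ j, S.mesh.normal e j • F j (c e.1)) +
      ∑ i, ∫ x in (S.mesh.cell i).region,
        ∑ j, fderiv ℝ ψ x (EuclideanSpace.single j 1) • (F j (u x) - F j (c i)) := by
    rw [hsum, hint]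
    abel
  rw [hall, add_mul]
  exact (norm_add_le _ _).trans (add_le_add hdev hrepl)

end Scheme

/-! ### The residual of the discrete weak form -/

namespace Scheme

variable {Ω : Set Plane} {T : EReal} {ν : ℕ} {S : Scheme Ω T ν}

/-- `W i` is twice the total deviation on cell `i`. This is finite: the mesh size is positive as
soon as there is a cell, so one infinite deviation would make the variation infinite. -/
lemma exists_oscBound (hS : S.supVariation ≠ ⊤) {n : ℕ} (hn : (S.t n : EReal) < T) :
    ∃ W, S.mesh.OscBound (S.q n) W ∧
      S.mesh.size ^ 2 * ∑ i, W i ≤ 2 * S.supVariation.toReal := by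
  set D : Fin S.mesh.ncell → ℝ≥0∞ := fun i => (S.mesh.cell i).deviation (S.q n) (closure Ω)
  have hle : ENNReal.ofReal (S.mesh.size ^ 2) * ∑ i, D i ≤ S.supVariation :=
    le_iSup₂ (f := fun n (_ : (S.t n : EReal) < T) => S.variation n) n hn
  have hfin : ∀ i, D i ≠ ⊤ := fun i hi => by
    have hpos : 0 < S.mesh.size := (S.mesh.cell i).diam_pos.trans_le (S.mesh.diam_le_size i)
    have hsum : ∑ i, D i = ⊤ := ENNReal.sum_eq_top.2 ⟨i, Finset.mem_univ i, hi⟩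
    rw [hsum, ENNReal.mul_top (by positivity)] at hle
    exact hS (top_le_iff.1 hle)
  refine ⟨fun i => 2 * (D i).toReal, ⟨fun i => by positivity, fun i x hx y hy => ?_⟩, ?_⟩
  · have h := (S.mesh.cell i).edist_le_deviation (S.q n) (S.mesh.region_subset i) hx hy
    rw [edist_dist, dist_eq_norm] at h
    have h' := ENNReal.toReal_mono (ENNReal.mul_ne_top (by simp) (hfin i)) h
    rwa [ENNReal.toReal_ofReal (norm_nonneg _), ENNReal.toReal_mul] at h'
  · have h := ENNReal.toReal_mono hS hle
    rw [ENNReal.toReal_mul, ENNReal.toReal_ofReal (by positivity),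
      ENNReal.toReal_sum fun i _ => hfin i] at h
    rw [← Finset.mul_sum]
    linarith

lemma dt_pos (S : Scheme Ω T ν) (n : ℕ) : 0 < S.dt n := sub_pos.2 (S.t_strictMono n.lt_succ_self)

lemma sum_dt (S : Scheme Ω T ν) (N : ℕ) : ∑ n ∈ Finset.range N, S.dt n = S.t N := by
  simp only [dt]
  rw [Finset.sum_range_sub, S.t_zero, sub_zero]

/-- Summation by parts in time. -/
lemma sum_range_smul_sub {E : Type*} [AddCommGroup E] [Module ℝ E] (a : ℕ → ℝ) (b : ℕ → E)
    (N : ℕ) : ∑ n ∈ Finset.range N, a (n + 1) • (b (n + 1) - b n) =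
      a N • b N - a 0 • b 0 - ∑ n ∈ Finset.range N, (a (n + 1) - a n) • b n := by
  rw [← Finset.sum_range_sub (fun n => a n • b n), ← Finset.sum_sub_distrib]
  exact Finset.sum_congr rfl fun n _ => by module

/-- The balance on each cell is multiplied by the time step and by the average of `ψ`; the average
times the area is the integral of `ψ`. -/
lemma Balance.sum_average_smul {Δ : ℕ → Fin S.mesh.ncell → State ν} (h : S.Balance Δ) {σ : ℝ}
    (hσ : 0 < σ) (hσS : ∀ i, (S.mesh.cell i).ShapeRegular σ) {n : ℕ} (hn : (S.t n : EReal) < T)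
    (ψ : Plane → ℝ) :
    ∑ i, (∫ x in (S.mesh.cell i).region, ψ x) • (S.avg (n + 1) i - S.avg n i) +
      S.dt n • ∑ i, (⨍ x in (S.mesh.cell i).region, ψ x) • ∑ k, S.flux n ⟨i, k⟩ (S.q n) =
      S.dt n • ∑ i, (∫ x in (S.mesh.cell i).region, ψ x) • Δ n i := by
  rw [Finset.smul_sum, Finset.smul_sum, ← Finset.sum_add_distrib]
  refine Finset.sum_congr rfl fun i _ => ?_
  have ha : (∫ x in (S.mesh.cell i).region, ψ x) =
      (⨍ x in (S.mesh.cell i).region, ψ x) * (S.mesh.cell i).area := by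
    rw [mul_comm, setAverage_eq, smul_eq_mul, PolygonalCell.area, mul_inv_cancel_left₀]
    exact ((S.mesh.cell i).area_pos hσ (hσS i)).ne'
  have hd : S.dt n • (S.dt n)⁻¹ • (S.avg (n + 1) i - S.avg n i) = S.avg (n + 1) i - S.avg n i :=
    smul_inv_smul₀ (S.dt_pos n).ne' _
  have hb := h n hn i
  rw [ha, mul_smul, mul_smul, ← hb]
  nth_rewrite 1 [← hd]
  module

/-- The discrete solution satisfies the weak form up to a residual that is controlled by its
variation, the conservation defect, and the mesh size. -/
lemma AdmissibleFlux.norm_weak_residual_le {F : Fin 2 → State ν → State ν} {U : Set (State ν)}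
    {L : ℝ} (h : S.AdmissibleFlux F U L) {K : NNReal} (hF : ∀ j, LipschitzWith K (F j)) {σ : ℝ}
    (hσ : 0 < σ) (hσS : ∀ i, (S.mesh.cell i).ShapeRegular σ)
    {Δ : ℕ → Fin S.mesh.ncell → State ν} (hΔ : S.Balance Δ) {δ ε τ : ℝ} (hδ0 : 0 ≤ δ)
    (hδ : ∀ n, (S.t n : EReal) < T → ∀ i, ‖Δ n i‖ ≤ δ)
    (hε : ∀ n, (S.t n : EReal) < T → ∃ W, S.mesh.OscBound (S.q n) W ∧
      S.mesh.size ^ 2 * ∑ i, W i ≤ ε)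
    (hτ : ∀ n, (S.t n : EReal) < T → S.dt n ≤ τ)
    {φ : Plane × ℝ → ℝ} (hφ : ContDiff ℝ 1 φ) {M : NNReal} (hM : LipschitzWith M φ) {B : ℝ}
    (hB : ∀ p, |φ p| ≤ B)
    (hφ0 : ∀ i, ((S.mesh.cell i).region ∩ frontier Ω).Nonempty →
      ∀ x ∈ (S.mesh.cell i).region, ∀ s, φ (x, s) = 0)
    {T' : ℝ} (hT'0 : 0 < T') (hT' : (T' : EReal) < T) (hφT : ∀ x s, T' ≤ s → φ (x, s) = 0)
    {N : ℕ} (hN : T' ≤ S.t N) (hN' : ∀ n < N, S.t n < T') :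
    ‖(∫ x in closure Ω, φ (x, 0) • S.q 0 x) +
      (∑ n ∈ Finset.range N, ∫ x in closure Ω, (φ (x, S.t (n + 1)) - φ (x, S.t n)) • S.q n x) +
      ∑ n ∈ Finset.range N, S.dt n • ∫ x in closure Ω,
        ∑ j, fderiv ℝ (fun y => φ (y, S.t (n + 1))) x (EuclideanSpace.single j 1) •
          F j (S.q n x)‖ ≤
      B * diskArea * ε + (T' + τ) * (M * diskArea * ε +
        (2 * M * |L| * σ + 2 * M * K * diskArea) * ε + B * volume.real (closure Ω) * δ) := by
  have hB0 : 0 ≤ B := (abs_nonneg _).trans (hB 0)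
  have hlt : ∀ n < N, (S.t n : EReal) < T := fun n hn =>
    (EReal.coe_lt_coe_iff.2 (hN' n hn)).trans hT'
  have hN0 : 0 < N := by
    rcases N.eq_zero_or_pos with rfl | h0
    · rw [S.t_zero] at hN
      linarith
    · exact h0
  have hφs : ∀ s : ℝ, ContDiff ℝ 1 fun x => φ (x, s) := fun s => by fun_prop
  have hMs : ∀ s : ℝ, LipschitzWith M fun x => φ (x, s) := fun s => by
    simpa [Function.comp_def] using hM.comp (LipschitzWith.prodMk_right (α := Plane) s)
  set w : ℕ → Fin S.mesh.ncell → ℝ := fun n i => ∫ x in (S.mesh.cell i).region, φ (x, S.t n)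
    with hw
  have hφi : ∀ s i, IntegrableOn (fun x => φ (x, s)) (S.mesh.cell i).region := fun s i =>
    (hφs s).continuous.continuousOn.integrableOn_compact (S.mesh.cell i).isCompact_region
  -- No boundary term at the final index: the test function vanishes from time `T'` on.
  have hwN : ∀ i, w N i = 0 := fun i =>
    setIntegral_eq_zero_of_forall_eq_zero fun x _ => hφT x _ hN
  -- the discrete weak form
  have hparts : (∑ n ∈ Finset.range N, ∑ i, w (n + 1) i • (S.avg (n + 1) i - S.avg n i)) =
      -(∑ i, w 0 i • S.avg 0 i) -
        ∑ n ∈ Finset.range N, ∑ i, (w (n + 1) i - w n i) • S.avg n i := by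
    rw [Finset.sum_comm, Finset.sum_comm (s := Finset.range N), ← Finset.sum_neg_distrib,
      ← Finset.sum_sub_distrib]
    refine Finset.sum_congr rfl fun i _ => ?_
    rw [sum_range_smul_sub (fun n => w n i) (fun n => S.avg n i), hwN]
    simp
  have hbal : (∑ n ∈ Finset.range N, ∑ i, w (n + 1) i • (S.avg (n + 1) i - S.avg n i)) +
      (∑ n ∈ Finset.range N, S.dt n • ∑ i, (⨍ x in (S.mesh.cell i).region, φ (x, S.t (n + 1))) •
        ∑ k, S.flux n ⟨i, k⟩ (S.q n)) =
      ∑ n ∈ Finset.range N, S.dt n • ∑ i, w (n + 1) i • Δ n i := by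
    rw [← Finset.sum_add_distrib]
    exact Finset.sum_congr rfl fun n hn =>
      hΔ.sum_average_smul hσ hσS (hlt n (Finset.mem_range.1 hn)) _
  rw [hparts] at hbal
  -- the errors
  have hinit : ‖(∑ i, w 0 i • S.avg 0 i) - ∫ x in closure Ω, φ (x, 0) • S.q 0 x‖ ≤
      B * diskArea * ε := by
    obtain ⟨W, hW, hWε⟩ := hε 0 (hlt 0 hN0)
    have := hW.norm_sum_average_sub_le (S.q_integrable 0) hσ hσS (hφs (S.t 0)).continuous hB0
      fun x => hB _
    rw [S.t_zero] at this
    simp only [hw, S.t_zero]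
    exact this.trans (mul_le_mul_of_nonneg_left hWε (mul_nonneg hB0 diskArea_nonneg))
  -- The increment of `φ` over a step is at most `M * S.dt n`. This factor lets the errors add up to
  -- a multiple of `S.t N`, independently of the number of steps.
  have htime : ∀ n < N, ‖(∑ i, (w (n + 1) i - w n i) • S.avg n i) -
      ∫ x in closure Ω, (φ (x, S.t (n + 1)) - φ (x, S.t n)) • S.q n x‖ ≤
      S.dt n * (M * diskArea * ε) := fun n hn => by
    obtain ⟨W, hW, hWε⟩ := hε n (hlt n hn)
    have := hW.norm_sum_average_sub_le (S.q_integrable n) hσ hσS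
      (ψ := fun x => φ (x, S.t (n + 1)) - φ (x, S.t n)) (B := M * S.dt n)
      ((hφs _).continuous.sub (hφs _).continuous) (mul_nonneg M.coe_nonneg (S.dt_pos n).le) fun x => by
        have h1 := hM.dist_le_mul (x, S.t (n + 1)) (x, S.t n)
        rw [Prod.dist_eq, dist_self, max_eq_right dist_nonneg] at h1
        rwa [Real.dist_eq, Real.dist_eq, ← dt, abs_of_pos (S.dt_pos n)] at h1
    simp only [hw]
    simp only [integral_sub (hφi _ _) (hφi _ _)] at this
    refine this.trans ((mul_le_mul_of_nonneg_left hWε (mul_nonneg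
      (mul_nonneg M.coe_nonneg (S.dt_pos n).le) diskArea_nonneg)).trans (le_of_eq (by ring)))
  have hspace : ∀ n < N, ‖(∑ i, (⨍ x in (S.mesh.cell i).region, φ (x, S.t (n + 1))) •
      ∑ k, S.flux n ⟨i, k⟩ (S.q n)) + ∫ x in closure Ω,
        ∑ j, fderiv ℝ (fun y => φ (y, S.t (n + 1))) x (EuclideanSpace.single j 1) •
          F j (S.q n x)‖ ≤ (2 * M * |L| * σ + 2 * M * K * diskArea) * ε := fun n hn => by
    obtain ⟨W, hW, hWε⟩ := hε n (hlt n hn)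
    refine (h.norm_sum_average_smul_flux_add_le hF hσ hσS n (S.q_mem n) (S.q_integrable n) hW
      (hφs (S.t (n + 1))) (hMs _) fun i hi x hx => hφ0 i hi x hx _).trans ?_
    refine mul_le_mul_of_nonneg_left hWε (add_nonneg ?_ ?_)
    · positivity
    · exact mul_nonneg (by positivity) diskArea_nonneg
  have hdefect : ∀ n < N, ‖∑ i, w (n + 1) i • Δ n i‖ ≤ B * volume.real (closure Ω) * δ :=
      fun n hn => by
    have harea : volume.real (closure Ω) = ∑ i, (S.mesh.cell i).area := by
      have := S.mesh.setIntegral_closure (f := fun _ => (1 : ℝ))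
        (integrableOn_const S.mesh.isCompact_closure.measure_lt_top.ne)
      simpa [PolygonalCell.area] using this
    rw [harea, Finset.mul_sum, Finset.sum_mul]
    refine norm_sum_le_of_le _ fun i _ => ?_
    rw [norm_smul]
    exact mul_le_mul (norm_setIntegral_le_of_norm_le_const
      (S.mesh.cell i).isCompact_region.measure_lt_top fun x _ => hB _) (hδ n (hlt n hn) i)
      (norm_nonneg _) (mul_nonneg hB0 measureReal_nonneg)
  have hsum : ∀ (f : ℕ → State ν) (b : ℝ), (∀ n < N, ‖f n‖ ≤ S.dt n * b) →
      ‖∑ n ∈ Finset.range N, f n‖ ≤ S.t N * b := fun f b hf => by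
    rw [← S.sum_dt, Finset.sum_mul]
    exact norm_sum_le_of_le _ fun n hn => hf n (Finset.mem_range.1 hn)
  have hdt : ∀ n (v : State ν) (b : ℝ), ‖v‖ ≤ b → ‖S.dt n • v‖ ≤ S.dt n * b := fun n v b hv => by
    rw [norm_smul, Real.norm_of_nonneg (S.dt_pos n).le]
    exact mul_le_mul_of_nonneg_left hv (S.dt_pos n).le
  -- Step `N - 1` still starts before `T'`, so it overshoots by at most one time step.
  have htN : S.t N ≤ T' + τ := by
    obtain ⟨k, rfl⟩ := Nat.exists_eq_succ_of_ne_zero hN0.ne'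
    have h1 := hN' k k.lt_succ_self
    have h2 := hτ k (hlt k k.lt_succ_self)
    rw [dt] at h2
    have : S.t (k + 1) = S.t k.succ := rfl
    linarith
  have e1 := hsum _ _ htime
  have e2 := hsum _ _ fun n hn => hdt n _ _ (hspace n hn)
  have e3 := hsum _ _ fun n hn => hdt n _ _ (hdefect n hn)
  rw [Finset.sum_sub_distrib] at e1
  simp only [smul_add, Finset.sum_add_distrib] at e2
  have hε0 : 0 ≤ ε := by
    obtain ⟨W, hW, hWε⟩ := hε 0 (hlt 0 hN0)
    exact (mul_nonneg (sq_nonneg _) (Finset.sum_nonneg fun i _ => hW.nonneg i)).trans hWε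
  set A' := ∑ i, w 0 i • S.avg 0 i
  set A := ∫ x in closure Ω, φ (x, 0) • S.q 0 x
  set X' := ∑ n ∈ Finset.range N, ∑ i, (w (n + 1) i - w n i) • S.avg n i
  set X := ∑ n ∈ Finset.range N, ∫ x in closure Ω, (φ (x, S.t (n + 1)) - φ (x, S.t n)) • S.q n x
  set Y' := ∑ n ∈ Finset.range N, S.dt n •
    ∑ i, (⨍ x in (S.mesh.cell i).region, φ (x, S.t (n + 1))) • ∑ k, S.flux n ⟨i, k⟩ (S.q n)
  set Y := ∑ n ∈ Finset.range N, S.dt n • ∫ x in closure Ω,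
    ∑ j, fderiv ℝ (fun y => φ (y, S.t (n + 1))) x (EuclideanSpace.single j 1) • F j (S.q n x)
  set Z := ∑ n ∈ Finset.range N, S.dt n • ∑ i, w (n + 1) i • Δ n i
  have hsplit : A + X + Y = -(A' - A) - (X' - X) + (Y' + Y) - Z := by
    rw [← hbal]
    abel
  rw [hsplit]
  have hb : 0 ≤ M * diskArea * ε + (2 * M * |L| * σ + 2 * M * K * diskArea) * ε +
      B * volume.real (closure Ω) * δ := by
    have := diskArea_nonneg
    positivity
  calc ‖-(A' - A) - (X' - X) + (Y' + Y) - Z‖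
      ≤ ‖A' - A‖ + ‖X' - X‖ + ‖Y' + Y‖ + ‖Z‖ := by
        refine (norm_sub_le _ _).trans (add_le_add_left ?_ _)
        refine (norm_add_le _ _).trans (add_le_add_left ?_ _)
        exact (norm_sub_le _ _).trans_eq (by rw [norm_neg])
    _ ≤ B * diskArea * ε + S.t N * (M * diskArea * ε) +
        S.t N * ((2 * M * |L| * σ + 2 * M * K * diskArea) * ε) +
        S.t N * (B * volume.real (closure Ω) * δ) := by gcongr
    _ = B * diskArea * ε + S.t N * (M * diskArea * ε +
        (2 * M * |L| * σ + 2 * M * K * diskArea) * ε + B * volume.real (closure Ω) * δ) := by ring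
    _ ≤ _ := by gcongr

end Scheme

/-! ### Convergence of the integrals and derivatives of the test function -/

/-- The difference of the integrands is `g m • (F (u m) - F u₀) + (g m - g₀) • F u₀`. The first part
is controlled by L¹ convergence with bounded weights, the second by uniform convergence of the
weights. The time term uses it with `F = id`, the flux term with weights shifted in time. -/
lemma tendsto_integral_smul_comp {X E : Type*} [MeasurableSpace X] {μ : Measure X}
    [NormedAddCommGroup E] [NormedSpace ℝ E] {F : E → E} {K : NNReal} (hF : LipschitzWith K F)
    {u : ℕ → X → E} {u₀ : X → E} {g : ℕ → X → ℝ} {g₀ : X → ℝ}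
    (hFu : Integrable (fun x => F (u₀ x)) μ) (hg₀ : AEStronglyMeasurable g₀ μ)
    (hint : ∀ m, Integrable (fun x => g m x • F (u m x)) μ)
    {B : ℝ} (hB : ∀ m x, |g m x| ≤ B) {η : ℕ → ℝ} (hη : Tendsto η atTop (𝓝 0))
    (hg : ∀ᶠ m in atTop, ∀ᵐ x ∂μ, |g m x - g₀ x| ≤ η m)
    (hu : Tendsto (fun m => ∫⁻ x, ‖u m x - u₀ x‖ₑ ∂μ) atTop (𝓝 0)) :
    Tendsto (fun m => ∫ x, g m x • F (u m x) ∂μ) atTop (𝓝 (∫ x, g₀ x • F (u₀ x) ∂μ)) := by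
  refine tendsto_integral_of_L1 _ (hg₀.smul hFu.aestronglyMeasurable) (.of_forall hint) ?_
  have hlim : Tendsto (fun m => ENNReal.ofReal B * K * (∫⁻ x, ‖u m x - u₀ x‖ₑ ∂μ) +
      ENNReal.ofReal (η m) * ∫⁻ x, ‖F (u₀ x)‖ₑ ∂μ) atTop (𝓝 0) := by
    have h1 := ENNReal.Tendsto.const_mul (a := ENNReal.ofReal B * K) hu
      (Or.inr (ENNReal.mul_ne_top ENNReal.ofReal_ne_top ENNReal.coe_ne_top))
    have h2 := ENNReal.Tendsto.mul_const (b := ∫⁻ x, ‖F (u₀ x)‖ₑ ∂μ)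
      (ENNReal.tendsto_ofReal hη) (Or.inr hFu.hasFiniteIntegral.ne)
    simpa using h1.add h2
  refine tendsto_of_tendsto_of_tendsto_of_le_of_le' tendsto_const_nhds hlim
    (.of_forall fun _ => zero_le) ?_
  filter_upwards [hg] with m hm
  rw [← lintegral_const_mul' _ _ (ENNReal.mul_ne_top ENNReal.ofReal_ne_top ENNReal.coe_ne_top),
    ← lintegral_const_mul' _ _ ENNReal.ofReal_ne_top,
    ← lintegral_add_right' _ (hFu.aestronglyMeasurable.enorm.const_mul _)]
  refine lintegral_mono_ae ?_
  filter_upwards [hm] with x hx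
  have hsplit : g m x • F (u m x) - g₀ x • F (u₀ x) =
      g m x • (F (u m x) - F (u₀ x)) + (g m x - g₀ x) • F (u₀ x) := by module
  change ‖g m x • F (u m x) - g₀ x • F (u₀ x)‖ₑ ≤ _
  rw [hsplit]
  refine (enorm_add_le _ _).trans (add_le_add ?_ ?_)
  · rw [enorm_smul, mul_assoc]
    refine mul_le_mul' ?_ ?_
    · rw [Real.enorm_eq_ofReal_abs]
      exact ENNReal.ofReal_le_ofReal (hB m x)
    · simpa [edist_eq_enorm_sub] using hF (u m x) (u₀ x)
  · rw [enorm_smul, Real.enorm_eq_ofReal_abs]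
    gcongr

lemma fderiv_section {φ : Plane × ℝ → ℝ} (hφ : ContDiff ℝ 1 φ) (x v : Plane) (s : ℝ) :
    fderiv ℝ (fun y => φ (y, s)) x v = fderiv ℝ φ (x, s) (v, 0) := by
  have h1 : HasFDerivAt (fun y : Plane => (y, s)) (ContinuousLinearMap.inl ℝ Plane ℝ) x :=
    hasFDerivAt_prodMk_left x s
  have h2 := ((hφ.differentiable one_ne_zero (x, s)).hasFDerivAt).comp x h1
  rw [show (fun y => φ (y, s)) = φ ∘ fun y => (y, s) from rfl, h2.fderiv]
  simp

lemma integral_fderiv_time {φ : Plane × ℝ → ℝ} (hφ : ContDiff ℝ 1 φ) (x : Plane) {a b : ℝ}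
    (hab : a ≤ b) : ∫ s in Set.Ico a b, fderiv ℝ φ (x, s) (0, 1) = φ (x, b) - φ (x, a) := by
  have hd : Continuous (fderiv ℝ φ) := hφ.continuous_fderiv one_ne_zero
  rw [integral_Ico_eq_integral_Ioc, ← intervalIntegral.integral_of_le hab]
  refine intervalIntegral.integral_eq_sub_of_hasDerivAt (f := fun s => φ (x, s)) (fun s _ => ?_)
    ((by fun_prop : Continuous _).intervalIntegrable _ _)
  have h1 : HasDerivAt (fun s : ℝ => (x, s)) ((0 : Plane), (1 : ℝ)) s :=
    (hasDerivAt_const s x).prodMk (hasDerivAt_id s)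
  exact ((hφ.differentiable one_ne_zero _).hasFDerivAt).comp_hasDerivAt s h1

/-! ### Space-time integrals, one time step at a time -/

namespace Scheme

variable {Ω : Set Plane} {T : EReal} {ν : ℕ} (S : Scheme Ω T ν)

/-- The number of the time step that contains the time `s`. -/
noncomputable def timeIndex (s : ℝ) : ℕ := sInf {n | s < S.t (n + 1)}

variable {S}

lemma timeIndex_eq {n : ℕ} {s : ℝ} (hs : s ∈ Set.Ico (S.t n) (S.t (n + 1))) :
    S.timeIndex s = n := by
  refine le_antisymm (Nat.sInf_le hs.2) (le_csInf ⟨n, hs.2⟩ fun k hk => ?_)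
  by_contra! hkn
  exact absurd (hs.1.trans_lt hk) (not_lt.2 (S.t_strictMono.monotone hkn))

lemma exists_mem_step {s : ℝ} (hs : 0 ≤ s) (hex : ∃ n, s < S.t n) :
    ∃ n, s ∈ Set.Ico (S.t n) (S.t (n + 1)) := by
  classical
  have hpos : Nat.find hex ≠ 0 := fun h0 => by
    have := Nat.find_spec hex
    rw [h0, S.t_zero] at this
    linarith
  obtain ⟨k, hk⟩ := Nat.exists_eq_succ_of_ne_zero hpos
  refine ⟨k, not_lt.1 (Nat.find_min hex (by omega)), ?_⟩
  have := Nat.find_spec hex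
  rwa [hk] at this

variable (S)

/-- The part of space-time that corresponds to the time step from `tⁿ` to `tⁿ⁺¹`. -/
def slab (n : ℕ) : Set (Plane × ℝ) := closure Ω ×ˢ Set.Ico (S.t n) (S.t (n + 1))

lemma measurableSet_slab (n : ℕ) : MeasurableSet (S.slab n) :=
  isClosed_closure.measurableSet.prod measurableSet_Ico

variable {S}

/-- Integrals over the first `N` time steps are computed step by step. -/
lemma integrableOn_and_setIntegral_steps {E : Type*} [NormedAddCommGroup E] [NormedSpace ℝ E]
    {f : ℕ → Plane × ℝ → E} (hf : ∀ n, IntegrableOn (f n) (S.slab n)) (N : ℕ) :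
    IntegrableOn (fun p => f (S.timeIndex p.2) p) (closure Ω ×ˢ Set.Ico 0 (S.t N)) ∧
    ∫ p in closure Ω ×ˢ Set.Ico 0 (S.t N), f (S.timeIndex p.2) p =
      ∑ n ∈ Finset.range N, ∫ p in S.slab n, f n p := by
  have heq : ∀ n, Set.EqOn (f n) (fun p => f (S.timeIndex p.2) p) (S.slab n) := fun n p hp => by
    simp only [timeIndex_eq hp.2]
  have hf' : ∀ n, IntegrableOn (fun p => f (S.timeIndex p.2) p) (S.slab n) := fun n =>
    (hf n).congr_fun (heq n) (S.measurableSet_slab n)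
  induction N with
  | zero => simp [S.t_zero]
  | succ N ih =>
    have h0 : 0 ≤ S.t N := S.t_zero ▸ S.t_strictMono.monotone N.zero_le
    have hunion : closure Ω ×ˢ Set.Ico 0 (S.t (N + 1)) =
        (closure Ω ×ˢ Set.Ico 0 (S.t N)) ∪ S.slab N := by
      rw [slab, ← Set.prod_union,
        Set.Ico_union_Ico_eq_Ico h0 (S.t_strictMono.monotone N.le_succ)]
    have hdisj : Disjoint (closure Ω ×ˢ Set.Ico 0 (S.t N)) (S.slab N) := by
      rw [Set.disjoint_left]
      rintro p ⟨-, hp⟩ ⟨-, hp'⟩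
      exact absurd hp.2 (not_lt.2 hp'.1)
    rw [hunion]
    refine ⟨ih.1.union (hf' N), ?_⟩
    rw [setIntegral_union hdisj (S.measurableSet_slab N) ih.1 (hf' N), ih.2,
      Finset.sum_range_succ, setIntegral_congr_fun (S.measurableSet_slab N) (heq N)]

lemma integrableOn_slab {E : Type*} [NormedAddCommGroup E] {f : Plane → E}
    (hf : IntegrableOn f (closure Ω)) (n : ℕ) : IntegrableOn (fun p => f p.1) (S.slab n) := by
  rw [IntegrableOn, slab, Measure.volume_eq_prod, ← Measure.prod_restrict]
  exact Integrable.comp_fst hf _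

lemma integrableOn_slab_smul {E : Type*} [NormedAddCommGroup E] [NormedSpace ℝ E] {f : Plane → E}
    (hf : IntegrableOn f (closure Ω)) (n : ℕ) {g : Plane × ℝ → ℝ} (hg : Continuous g) {B : ℝ}
    (hB : ∀ p, |g p| ≤ B) : IntegrableOn (fun p => g p • f p.1) (S.slab n) :=
  (integrableOn_slab hf n).bdd_smul B hg.aestronglyMeasurable (.of_forall hB)

/-- The discrete solution does not depend on time within a slab, so Fubini and the fundamental
theorem of calculus make the discrete time derivative exact. -/
lemma setIntegral_slab_fderiv_time {φ : Plane × ℝ → ℝ} (hφ : ContDiff ℝ 1 φ) {B : ℝ}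
    (hB : ∀ p, |fderiv ℝ φ p (0, 1)| ≤ B) (n : ℕ) :
    ∫ p in S.slab n, fderiv ℝ φ p (0, 1) • S.q n p.1 =
      ∫ x in closure Ω, (φ (x, S.t (n + 1)) - φ (x, S.t n)) • S.q n x := by
  have hd : Continuous (fderiv ℝ φ) := hφ.continuous_fderiv one_ne_zero
  have hi := integrableOn_slab_smul (S := S) (S.q_integrable n) n
    (g := fun p => fderiv ℝ φ p (0, 1)) (by fun_prop) hB
  rw [slab, Measure.volume_eq_prod] at *
  rw [setIntegral_prod _ hi]
  simp only [integral_smul_const]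
  simp only [integral_fderiv_time hφ _ (S.t_strictMono n.lt_succ_self).le]

lemma setIntegral_slab_const {E : Type*} [NormedAddCommGroup E] [NormedSpace ℝ E]
    [CompleteSpace E] {f : Plane → E}
    (hf : IntegrableOn f (closure Ω)) (n : ℕ) :
    ∫ p in S.slab n, f p.1 = S.dt n • ∫ x in closure Ω, f x := by
  have hi := integrableOn_slab (S := S) hf n
  rw [slab, Measure.volume_eq_prod] at *
  rw [setIntegral_prod _ hi]
  have hvol : volume.real (Set.Ico (S.t n) (S.t (n + 1))) = S.dt n := by
    rw [Real.volume_real_Ico, ← dt, max_eq_left (S.dt_pos n).le]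
  simp only [setIntegral_const, hvol]
  rw [integral_smul]

end Scheme

/-! ### The space-time domain and the values of the limit -/

lemma measurableSet_spaceTime {Ω : Set Plane} (hΩ : IsOpen Ω) (T : EReal) :
    MeasurableSet (spaceTime Ω T) := by
  have h1 : MeasurableSet {p : Plane × ℝ | p.1 ∈ Ω} := measurable_fst hΩ.measurableSet
  have h2 : MeasurableSet {p : Plane × ℝ | 0 ≤ p.2} := measurableSet_le measurable_const measurable_snd
  have h3 : MeasurableSet {p : Plane × ℝ | (p.2 : EReal) < T} :=
    measurableSet_lt measurable_snd.coe_real_ereal measurable_const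
  exact h1.inter (h2.inter h3)

/-- Every point of the space-time domain has a compact neighbourhood in it. -/
lemma exists_isCompact_mem_nhdsWithin_spaceTime {Ω : Set Plane} (hΩ : IsOpen Ω) {T : EReal}
    {p : Plane × ℝ} (hp : p ∈ spaceTime Ω T) :
    ∃ K ⊆ spaceTime Ω T, IsCompact K ∧ K ∈ 𝓝[spaceTime Ω T] p := by
  have hopen : IsOpen {p : Plane × ℝ | p.1 ∈ Ω ∧ (p.2 : EReal) < T} :=
    (hΩ.preimage continuous_fst).inter
      (isOpen_lt (continuous_coe_real_ereal.comp continuous_snd) continuous_const)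
  obtain ⟨K, hK, hKsub, hKc⟩ := local_compact_nhds (hopen.mem_nhds ⟨hp.1, hp.2.2⟩)
  refine ⟨K ∩ {p | 0 ≤ p.2}, fun x hx => ⟨(hKsub hx.1).1, hx.2, (hKsub hx.1).2⟩,
    hKc.inter_right (isClosed_le continuous_const continuous_snd), ?_⟩
  filter_upwards [mem_nhdsWithin_of_mem_nhds hK, self_mem_nhdsWithin] with x hx hx'
  exact ⟨hx, hx'.2.1⟩

/-- The limit of functions with values in a closed set has values in this set. -/
lemma ae_mem_of_tendsto_lintegral_enorm_sub {X E : Type*} [MeasurableSpace X] {μ : Measure X}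
    [NormedAddCommGroup E] [MeasurableSpace E] [OpensMeasurableSpace E]
    {U : Set E} (hU : IsClosed U) {u : ℕ → X → E} {u₀ : X → E} (hu₀ : AEMeasurable u₀ μ)
    (hmem : ∀ m, ∀ᵐ x ∂μ, u m x ∈ U)
    (hu : Tendsto (fun m => ∫⁻ x, ‖u m x - u₀ x‖ₑ ∂μ) atTop (𝓝 0)) : ∀ᵐ x ∂μ, u₀ x ∈ U := by
  have h0 : ∫⁻ x, Metric.infEDist (u₀ x) U ∂μ = 0 := by
    refine le_antisymm (ge_of_tendsto' hu fun m => lintegral_mono_ae ?_) zero_le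
    filter_upwards [hmem m] with x hx
    rw [← edist_eq_enorm_sub, edist_comm]
    exact Metric.infEDist_le_edist_of_mem hx
  have hm : AEMeasurable (fun x => Metric.infEDist (u₀ x) U) μ :=
    Metric.continuous_infEDist.measurable.comp_aemeasurable hu₀
  rw [lintegral_eq_zero_iff' hm] at h0
  filter_upwards [h0] with x hx
  have hne : U.Nonempty := by
    by_contra hne
    rw [Set.not_nonempty_iff_eq_empty] at hne
    simp [hne] at hx
  exact (Metric.mem_iff_infEDist_zero_of_closed hU).2 hx

/-- A property that holds almost everywhere on compact subsets of the space-time domain holds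
almost everywhere. -/
lemma ae_restrict_spaceTime {Ω : Set Plane} (hΩ : IsOpen Ω) {T : EReal} {s : Set (Plane × ℝ)}
    (h : ∀ K ⊆ spaceTime Ω T, IsCompact K → ∀ᵐ p ∂(volume.restrict K), p ∈ s) :
    ∀ᵐ p ∂(volume.restrict (spaceTime Ω T)), p ∈ s := by
  rw [ae_restrict_iff' (measurableSet_spaceTime hΩ T)]
  have hnull : volume (spaceTime Ω T ∩ sᶜ) = 0 := by
    refine measure_null_of_locally_null _ fun p hp => ?_
    obtain ⟨K, hK, hKc, hKp⟩ := exists_isCompact_mem_nhdsWithin_spaceTime hΩ hp.1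
    have hae := h K hK hKc
    rw [ae_restrict_iff' hKc.measurableSet] at hae
    refine ⟨K ∩ (spaceTime Ω T ∩ sᶜ), inter_mem
      (nhdsWithin_mono _ Set.inter_subset_left hKp) self_mem_nhdsWithin,
      measure_mono_null (fun x hx => ?_) hae⟩
    exact fun hx' => hx.2.2 (hx' hx.1)
  refine measure_mono_null (fun x hx => ?_) hnull
  simpa using hx

lemma LipschitzWith.locallyIntegrableOn_comp {E E' : Type*} [NormedAddCommGroup E]
    [NormedAddCommGroup E'] {g : E → E'} {K : NNReal} (hg : LipschitzWith K g)
    {f : Plane × ℝ → E} {s : Set (Plane × ℝ)} (hf : LocallyIntegrableOn f s) :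
    LocallyIntegrableOn (fun p => g (f p)) s := by
  intro p hp
  obtain ⟨t, ht, hft⟩ := hf p hp
  -- The ball makes the measure finite, which is needed because `g 0` need not vanish.
  refine ⟨t ∩ Metric.closedBall p 1,
    inter_mem ht (mem_nhdsWithin_of_mem_nhds (Metric.closedBall_mem_nhds p one_pos)), ?_⟩
  exact hg.integrableOn_comp (hft.mono_set Set.inter_subset_left)
    ((measure_mono Set.inter_subset_right).trans_lt (isCompact_closedBall p 1).measure_lt_top).ne

lemma abs_fderiv_apply_le {φ : Plane × ℝ → ℝ} {M : NNReal} (hM : LipschitzWith M φ)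
    {v : Plane × ℝ} (hv : ‖v‖ ≤ 1) (p : Plane × ℝ) : |fderiv ℝ φ p v| ≤ M := by
  have h1 := (fderiv ℝ φ p).le_opNorm v
  have h2 := norm_fderiv_le_of_lipschitz ℝ hM (x₀ := p)
  rw [← Real.norm_eq_abs]
  nlinarith [norm_nonneg v, norm_nonneg (fderiv ℝ φ p)]

lemma norm_single_zero_le (j : Fin 2) :
    ‖((EuclideanSpace.single j 1 : Plane), (0 : ℝ))‖ ≤ 1 := by
  simp [Prod.norm_def]

lemma norm_zero_one_le : ‖((0 : Plane), (1 : ℝ))‖ ≤ 1 := by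
  simp [Prod.norm_def]

/-! ### The discrete terms as integrals over a set independent of the scheme -/

namespace Scheme

variable {Ω : Set Plane} {T : EReal} {ν : ℕ}

/-- The end of the time step that contains the time `s`. -/
noncomputable def nextTime (S : Scheme Ω T ν) (s : ℝ) : ℝ := S.t (S.timeIndex s + 1)

variable {S : Scheme Ω T ν}

lemma sub_nextTime_mem {s : ℝ} (hs : 0 ≤ s) (hsT : (s : EReal) < T) :
    s < S.nextTime s ∧ ∃ n, (S.t n : EReal) < T ∧ S.nextTime s - s ≤ S.dt n := by
  obtain ⟨n, hn⟩ := S.exists_mem_step hs (S.t_exhaust s hsT)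
  rw [nextTime, timeIndex_eq hn]
  exact ⟨hn.2, n, (EReal.coe_le_coe_iff.2 hn.1).trans_lt hsT, by rw [dt]; linarith [hn.1]⟩

/-- The discrete time derivative, as an integral over space-time. -/
lemma sum_setIntegral_time_eq {φ : Plane × ℝ → ℝ} (hφ : ContDiff ℝ 1 φ) {M : NNReal}
    (hM : LipschitzWith M φ) {Kx : Set Plane} (hKΩ : Kx ⊆ closure Ω)
    {T' : ℝ} (hsupp : ∀ p ∈ tsupport φ, p.1 ∈ Kx ∧ p.2 < T') {N : ℕ} (hN : T' ≤ S.t N) :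
    IntegrableOn (fun p => fderiv ℝ φ p (0, 1) • S.qh p) (Kx ×ˢ Set.Ico 0 T') ∧
    ∑ n ∈ Finset.range N, ∫ x in closure Ω, (φ (x, S.t (n + 1)) - φ (x, S.t n)) • S.q n x =
      ∫ p in Kx ×ˢ Set.Ico 0 T', fderiv ℝ φ p (0, 1) • S.qh p := by
  have hd : Continuous (fderiv ℝ φ) := hφ.continuous_fderiv one_ne_zero
  have hB := abs_fderiv_apply_le hM norm_zero_one_le
  have hsub : Kx ×ˢ Set.Ico 0 T' ⊆ closure Ω ×ˢ Set.Ico 0 (S.t N) :=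
    Set.prod_mono hKΩ (Set.Ico_subset_Ico_right hN)
  -- By definition, `S.qh p` is `S.q n p.1` at `n = S.timeIndex p.2`.
  have hsteps := integrableOn_and_setIntegral_steps (S := S)
    (f := fun n p => fderiv ℝ φ p (0, 1) • S.q n p.1)
    (fun n => integrableOn_slab_smul (S.q_integrable n) n (by fun_prop) hB) N
  refine ⟨hsteps.1.mono_set hsub, ?_⟩
  simp only [setIntegral_slab_fderiv_time hφ hB] at hsteps
  rw [← hsteps.2]
  refine setIntegral_eq_of_subset_of_forall_sdiff_eq_zero
    (isClosed_closure.measurableSet.prod measurableSet_Ico) hsub fun p hp => ?_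
  rw [fderiv_of_notMem_tsupport, zero_apply, zero_smul]
  exact fun hpφ => hp.2 ⟨(hsupp p hpφ).1, hp.1.2.1, (hsupp p hpφ).2⟩

/-- The discrete flux term, as an integral over space-time. -/
lemma sum_setIntegral_space_eq {φ : Plane × ℝ → ℝ} (hφ : ContDiff ℝ 1 φ) {F : State ν → State ν}
    {K : NNReal} (hF : LipschitzWith K F) {Kx : Set Plane}
    (hKΩ : Kx ⊆ closure Ω) {T' : ℝ}
    (hsupp : ∀ p ∈ tsupport φ, p.1 ∈ Kx ∧ p.2 < T') {N : ℕ} (hN : T' ≤ S.t N)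
    (v : Plane) :
    IntegrableOn (fun p => fderiv ℝ φ (p.1, S.nextTime p.2) (v, 0) • F (S.qh p))
      (Kx ×ˢ Set.Ico 0 T') ∧
    ∑ n ∈ Finset.range N, S.dt n • ∫ x in closure Ω,
      fderiv ℝ (fun y => φ (y, S.t (n + 1))) x v • F (S.q n x) =
      ∫ p in Kx ×ˢ Set.Ico 0 T', fderiv ℝ φ (p.1, S.nextTime p.2) (v, 0) • F (S.qh p) := by
  have hd : Continuous (fderiv ℝ φ) := hφ.continuous_fderiv one_ne_zero
  have hsub : Kx ×ˢ Set.Ico 0 T' ⊆ closure Ω ×ˢ Set.Ico 0 (S.t N) :=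
    Set.prod_mono hKΩ (Set.Ico_subset_Ico_right hN)
  have hint : ∀ n, IntegrableOn (fun x => fderiv ℝ φ (x, S.t (n + 1)) (v, 0) • F (S.q n x))
      (closure Ω) := fun n =>
    (hF.integrableOn_comp (S.q_integrable n)
      S.mesh.isCompact_closure.measure_lt_top.ne).continuousOn_smul
      (by fun_prop) S.mesh.isCompact_closure
  have hsteps := integrableOn_and_setIntegral_steps (S := S)
    (f := fun n p => fderiv ℝ φ (p.1, S.t (n + 1)) (v, 0) • F (S.q n p.1))
    (fun n => integrableOn_slab (hint n) n) N
  refine ⟨hsteps.1.mono_set hsub, ?_⟩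
  simp only [setIntegral_slab_const (hint _)] at hsteps
  simp only [fderiv_section hφ]
  rw [← hsteps.2]
  refine setIntegral_eq_of_subset_of_forall_sdiff_eq_zero
    (isClosed_closure.measurableSet.prod measurableSet_Ico) hsub fun p hp => ?_
  rw [fderiv_of_notMem_tsupport, zero_apply, zero_smul]
  intro hpφ
  have h1 := hsupp _ hpφ
  refine hp.2 ⟨h1.1, hp.1.2.1, ?_⟩
  -- The support condition holds at the end of the time step, which is later than `p.2`; so `p.2 <
  -- T'` as well.
  by_contra! hge
  obtain ⟨n, hn⟩ := S.exists_mem_step hp.1.2.1 ⟨N, hp.1.2.2⟩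
  rw [timeIndex_eq hn] at h1
  linarith [h1.2, hn.2]

end Scheme

/-! ### Passage to the limit -/

/-- A compact subset of `Ω × (-∞, T)` stays away from the final time `T`. -/
lemma exists_time_bound {T : EReal} (hT : 0 < T) {K : Set (Plane × ℝ)} (hK : IsCompact K)
    (hKT : ∀ p ∈ K, (p.2 : EReal) < T) :
    ∃ T' : ℝ, 0 < T' ∧ (T' : EReal) < T ∧ ∀ p ∈ K, p.2 < T' := by
  obtain ⟨s, hs, hsK⟩ : ∃ s : ℝ, ((max s 0 : ℝ) : EReal) < T ∧ ∀ p ∈ K, p.2 ≤ s := by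
    rcases K.eq_empty_or_nonempty with rfl | hne
    · exact ⟨0, by simpa using hT, by simp⟩
    · obtain ⟨p, hp, hmax⟩ := hK.exists_isMaxOn hne continuous_snd.continuousOn
      refine ⟨p.2, ?_, fun x hx => hmax hx⟩
      rcases max_choice p.2 0 with h | h
      · rw [h]; exact hKT p hp
      · rw [h]; exact_mod_cast hT
  obtain ⟨T', h1, h2⟩ := EReal.lt_iff_exists_real_btwn.1 hs
  rw [EReal.coe_lt_coe_iff, max_lt_iff] at h1
  exact ⟨T', h1.2, h2, fun p hp => (hsK p hp).trans_lt h1.1⟩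

/-- Weak convergence of the initial data, in terms of integrals over the closure of the domain. -/
lemma tendsto_setIntegral_closure_smul {ν : ℕ} {Ω : Set Plane} (hΩ : IsOpen Ω)
    {ψ : Plane → ℝ} (hψ : Continuous ψ) {K : Set Plane} (hK : IsCompact K) (hKΩ : K ⊆ Ω)
    (hψK : ∀ x ∉ K, ψ x = 0) (hΩc : IsCompact (closure Ω)) {u : ℕ → Plane → State ν}
    (hu : ∀ m, IntegrableOn (u m) (closure Ω)) {u₀ : Plane → State ν}
    (hu₀ : LocallyIntegrableOn u₀ Ω)
    (hlim : Tendsto (fun m => ∫ x in Ω, ψ x • (u m x - u₀ x)) atTop (𝓝 0)) :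
    Tendsto (fun m => ∫ x in closure Ω, ψ x • u m x) atTop (𝓝 (∫ x in Ω, ψ x • u₀ x)) := by
  have hi₀ : IntegrableOn (fun x => ψ x • u₀ x) Ω :=
    IntegrableOn.of_forall_sdiff_eq_zero
      ((hu₀.integrableOn_compact_subset hKΩ hK).continuousOn_smul hψ.continuousOn hK)
      hΩ.measurableSet fun x hx => by rw [hψK x hx.2, zero_smul]
  have hi : ∀ m, IntegrableOn (fun x => ψ x • u m x) Ω := fun m =>
    ((hu m).continuousOn_smul hψ.continuousOn hΩc).mono_set subset_closure
  have heq : ∀ m, ∫ x in closure Ω, ψ x • u m x =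
      (∫ x in Ω, ψ x • (u m x - u₀ x)) + ∫ x in Ω, ψ x • u₀ x := fun m => by
    simp only [smul_sub]
    rw [integral_sub (hi m) hi₀, sub_add_cancel]
    refine setIntegral_eq_of_subset_of_forall_sdiff_eq_zero isClosed_closure.measurableSet
      subset_closure fun x hx => ?_
    rw [hψK x fun hxK => hx.2 (hKΩ hxK), zero_smul]
  simp only [heq]
  simpa using hlim.add_const (∫ x in Ω, ψ x • u₀ x)

/-- The weak form of the conservation law for the limit of the discrete solutions, for a flux that
is Lipschitz continuous on the whole space. -/
lemma weak_form_of_lipschitzWith {ν : ℕ} {Ω : Set Plane} (hΩ : IsOpen Ω) {T : EReal} (hT : 0 < T)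
    {U : Set (State ν)} {F : Fin 2 → State ν → State ν} {K : NNReal}
    (hF : ∀ j, LipschitzWith K (F j)) (S : ℕ → Scheme Ω T ν)
    (hsize : Tendsto (fun m => (S m).mesh.size) atTop (𝓝 0))
    (hstep : Tendsto (fun m => (S m).maxStep) atTop (𝓝 0))
    {σ : ℝ} (hσ : 0 < σ) (hshape : ∀ m i, ((S m).mesh.cell i).ShapeRegular σ)
    {L : ℝ} (hflux : ∀ m, (S m).AdmissibleFlux F U L)
    {Δ : (m : ℕ) → ℕ → Fin (S m).mesh.ncell → State ν} (hbalance : ∀ m, (S m).Balance (Δ m))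
    (hdefect : Tendsto (fun m => (S m).supDefect (Δ m)) atTop (𝓝 0))
    {q₀ : Plane → State ν} (hq₀ : LocallyIntegrableOn q₀ Ω)
    (hinit : ∀ ψ : Plane → ℝ, ContDiff ℝ ∞ ψ → HasCompactSupport ψ → tsupport ψ ⊆ Ω →
      Tendsto (fun m => ∫ x in Ω, ψ x • ((S m).q 0 x - q₀ x)) atTop (𝓝 0))
    (htvb : Tendsto (fun m => (S m).supVariation) atTop (𝓝 0))
    {q : Plane × ℝ → State ν} (hq : LocallyIntegrableOn q (spaceTime Ω T))
    (hconv : ∀ K : Set (Plane × ℝ), IsCompact K → K ⊆ spaceTime Ω T →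
      Tendsto (fun m => ∫⁻ p in K, ‖(S m).qh p - q p‖ₑ) atTop (𝓝 0))
    {φ : Plane × ℝ → ℝ} (hφ : ContDiff ℝ ∞ φ) (hφc : HasCompactSupport φ)
    (hφΩ : tsupport φ ⊆ {p | p.1 ∈ Ω ∧ (p.2 : EReal) < T}) :
    (∫ x in Ω, φ (x, 0) • q₀ x) +
      (∫ p in spaceTime Ω T, fderiv ℝ φ p (0, 1) • q p) +
      (∫ p in spaceTime Ω T,
        ∑ j, fderiv ℝ φ p (EuclideanSpace.single j 1, 0) • F j (q p)) = 0 := by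
  -- the test function
  have hφ1 : ContDiff ℝ 1 φ := hφ.of_le (mod_cast le_top)
  have hd1 : ContDiff ℝ 1 (fderiv ℝ φ) := (contDiff_infty_iff_fderiv.1 hφ).2.of_le (mod_cast le_top)
  obtain ⟨M, hM⟩ := hφ1.lipschitzWith_of_hasCompactSupport hφc one_ne_zero
  obtain ⟨M', hM'⟩ := hd1.lipschitzWith_of_hasCompactSupport (hφc.fderiv ℝ) one_ne_zero
  obtain ⟨B, hB⟩ := hφ1.continuous.bounded_above_of_compact_support hφc
  obtain ⟨T', hT'0, hT', hφT⟩ := exists_time_bound hT hφc fun p hp => (hφΩ hp).2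
  set Kx : Set Plane := Prod.fst '' tsupport φ
  have hKxc : IsCompact Kx := hφc.isCompact.image continuous_fst
  have hKxΩ : Kx ⊆ Ω := by
    rintro _ ⟨p, hp, rfl⟩
    exact (hφΩ hp).1
  have hsupp : ∀ p ∈ tsupport φ, p.1 ∈ Kx ∧ p.2 < T' := fun p hp => ⟨⟨p, hp, rfl⟩, hφT p hp⟩
  have hφ0 : ∀ x ∉ Kx, ∀ s, φ (x, s) = 0 := fun x hx s =>
    image_eq_zero_of_notMem_tsupport fun h => hx (hsupp _ h).1
  have hφT0 : ∀ x s, T' ≤ s → φ (x, s) = 0 := fun x s hs =>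
    image_eq_zero_of_notMem_tsupport fun h => absurd (hsupp _ h).2 (not_lt.2 hs)
  -- the space-time set that contains its support
  set K₀ : Set (Plane × ℝ) := Kx ×ˢ Set.Ico 0 T'
  -- The half-open set matches the time steps; the compact set around it is where L¹ convergence is
  -- assumed.
  have hKc : IsCompact (Kx ×ˢ Set.Icc 0 T') := hKxc.prod isCompact_Icc
  have hKsub : Kx ×ˢ Set.Icc 0 T' ⊆ spaceTime Ω T := fun p hp =>
    ⟨hKxΩ hp.1, hp.2.1, (EReal.coe_le_coe_iff.2 hp.2.2).trans_lt hT'⟩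
  have hK₀K : K₀ ⊆ Kx ×ˢ Set.Icc 0 T' := Set.prod_mono_right Set.Ico_subset_Icc_self
  have hK₀m : MeasurableSet K₀ := hKxc.measurableSet.prod measurableSet_Ico
  have hK₀fin : volume K₀ ≠ ⊤ := ((measure_mono hK₀K).trans_lt hKc.measure_lt_top).ne
  have hqK : IntegrableOn q K₀ :=
    (hq.integrableOn_compact_subset hKsub hKc).mono_set hK₀K
  have hconvK : Tendsto (fun m => ∫⁻ p in K₀, ‖(S m).qh p - q p‖ₑ) atTop (𝓝 0) :=
    tendsto_of_tendsto_of_tendsto_of_le_of_le tendsto_const_nhds (hconv _ hKc hKsub)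
      (fun _ => zero_le) fun _ => lintegral_mono_set hK₀K
  have hrestrict : ∀ f : Plane × ℝ → State ν, (∀ p ∉ tsupport φ, f p = 0) →
      ∫ p in spaceTime Ω T, f p = ∫ p in K₀, f p := fun f hf => by
    refine setIntegral_eq_of_subset_of_forall_sdiff_eq_zero (measurableSet_spaceTime hΩ T)
      (hK₀K.trans hKsub) fun p hp => hf p fun hpφ => hp.2 ?_
    exact ⟨(hsupp p hpφ).1, hp.1.2.1, (hsupp p hpφ).2⟩
  have hd : Continuous (fderiv ℝ φ) := hd1.continuous
  -- bounds on the data of the schemes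
  set ε : ℕ → ℝ := fun m => 2 * (S m).supVariation.toReal
  set δ : ℕ → ℝ := fun m => ((S m).supDefect (Δ m)).toReal
  set τ : ℕ → ℝ := fun m => (S m).maxStep.toReal
  have hεlim : Tendsto ε atTop (𝓝 0) := by
    simpa using ((ENNReal.tendsto_toReal ENNReal.zero_ne_top).comp htvb).const_mul 2
  have hδlim : Tendsto δ atTop (𝓝 0) := by
    simpa [Function.comp_def] using (ENNReal.tendsto_toReal ENNReal.zero_ne_top).comp hdefect
  have hτlim : Tendsto τ atTop (𝓝 0) := by
    simpa [Function.comp_def] using (ENNReal.tendsto_toReal ENNReal.zero_ne_top).comp hstep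
  -- As `toReal` sends `⊤` to `0`, the real bounds are valid only once the suprema are finite, that
  -- is, for large `m`.
  have hτle : ∀ᶠ m in atTop, ∀ n, ((S m).t n : EReal) < T → (S m).dt n ≤ τ m := by
    filter_upwards [hstep.eventually_lt_const ENNReal.zero_lt_top] with m hm n hn
    rw [← ENNReal.ofReal_le_iff_le_toReal hm.ne]
    exact le_iSup₂ (f := fun n (_ : ((S m).t n : EReal) < T) => ENNReal.ofReal ((S m).dt n)) n hn
  have hδle : ∀ᶠ m in atTop, ∀ n, ((S m).t n : EReal) < T → ∀ i, ‖Δ m n i‖ ≤ δ m := by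
    filter_upwards [hdefect.eventually_lt_const ENNReal.zero_lt_top] with m hm n hn i
    rw [← ENNReal.ofReal_le_iff_le_toReal hm.ne, ofReal_norm]
    exact (le_iSup (fun i => ‖Δ m n i‖ₑ) i).trans
      (le_iSup₂ (f := fun n (_ : ((S m).t n : EReal) < T) => ⨆ i, ‖Δ m n i‖ₑ) n hn)
  -- A cell of diameter below `r` cannot meet both `Kx` and the frontier of `Ω`, so the boundary
  -- fluxes drop out.
  have hfar : ∀ᶠ m in atTop, ∀ i, (((S m).mesh.cell i).region ∩ frontier Ω).Nonempty →
      ∀ x ∈ ((S m).mesh.cell i).region, ∀ s, φ (x, s) = 0 := by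
    obtain ⟨r, hr, hrΩ⟩ := hKxc.exists_thickening_subset_open hΩ hKxΩ
    filter_upwards [hsize.eventually_lt_const hr] with m hm i hi x hx s
    obtain ⟨z, hz, hzΩ⟩ := hi
    refine hφ0 x (fun hxK => ?_) s
    rw [hΩ.frontier_eq] at hzΩ
    refine hzΩ.2 (hrΩ (Metric.mem_thickening_iff.2 ⟨x, hxK, ?_⟩))
    exact ((((S m).mesh.cell i).dist_le_diam hz hx).trans
      ((S m).mesh.diam_le_size i)).trans_lt hm
  -- the limits of the three terms
  have hA : Tendsto (fun m => ∫ x in closure Ω, φ (x, 0) • (S m).q 0 x) atTop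
      (𝓝 (∫ x in Ω, φ (x, 0) • q₀ x)) := by
    have hs : Function.support (fun x => φ (x, 0)) ⊆ Kx := fun x hx => by
      by_contra hxK
      exact hx (hφ0 x hxK 0)
    refine tendsto_setIntegral_closure_smul hΩ (hφ1.continuous.comp (by fun_prop)) hKxc hKxΩ
      (fun x hx => hφ0 x hx 0) (S 0).mesh.isCompact_closure (fun m => (S m).q_integrable 0) hq₀ ?_
    refine hinit _ (hφ.comp (contDiff_id.prodMk contDiff_const))
      (HasCompactSupport.of_support_subset_isCompact hKxc hs)
      ((closure_minimal hs hKxc.isClosed).trans hKxΩ)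
  choose N₀ hN₀ using fun m => (S m).t_exhaust T' hT'
  classical
  have hNex : ∀ m, ∃ n, T' ≤ (S m).t n := fun m => ⟨N₀ m, (hN₀ m).le⟩
  -- By minimality every step before `N m` starts before `T'`, hence before `T`, where the balance
  -- is available.
  set N : ℕ → ℕ := fun m => Nat.find (hNex m)
  have hN : ∀ m, T' ≤ (S m).t (N m) := fun m => Nat.find_spec (hNex m)
  have hN' : ∀ m, ∀ n < N m, (S m).t n < T' := fun m n hn => not_le.1 (Nat.find_min (hNex m) hn)
  have htime := fun m => Scheme.sum_setIntegral_time_eq (S := S m) hφ1 hM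
    (hKxΩ.trans subset_closure) hsupp (hN m)
  have hspace := fun m (j : Fin 2) => Scheme.sum_setIntegral_space_eq (S := S m) hφ1 (hF j)
    (hKxΩ.trans subset_closure) hsupp (hN m) (EuclideanSpace.single j 1)
  have hBlim : Tendsto (fun m => ∫ p in K₀, fderiv ℝ φ p (0, 1) • (S m).qh p) atTop
      (𝓝 (∫ p in spaceTime Ω T, fderiv ℝ φ p (0, 1) • q p)) := by
    rw [hrestrict _ fun p hp => by
      rw [fderiv_of_notMem_tsupport ℝ hp, zero_apply, zero_smul]]
    exact tendsto_integral_smul_comp (F := id) (g := fun _ p => fderiv ℝ φ p (0, 1))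
      LipschitzWith.id hqK
      (by fun_prop : Continuous fun p => fderiv ℝ φ p (0, 1)).aestronglyMeasurable
      (fun m => (htime m).1) (fun _ => abs_fderiv_apply_le hM norm_zero_one_le)
      (tendsto_const_nhds (x := (0 : ℝ))) (.of_forall fun m => .of_forall fun p => by simp) hconvK
  have hClim : ∀ j : Fin 2, Tendsto (fun m => ∫ p in K₀,
      fderiv ℝ φ (p.1, (S m).nextTime p.2) (EuclideanSpace.single j 1, 0) • F j ((S m).qh p)) atTop
      (𝓝 (∫ p in K₀, fderiv ℝ φ p (EuclideanSpace.single j 1, 0) • F j (q p))) := fun j => by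
    refine tendsto_integral_smul_comp (hF j) ((hF j).integrableOn_comp hqK hK₀fin)
      (by fun_prop : Continuous fun p =>
        fderiv ℝ φ p (EuclideanSpace.single j 1, 0)).aestronglyMeasurable
      (fun m => (hspace m j).1) (fun m p => abs_fderiv_apply_le hM (norm_single_zero_le j) _)
      (η := fun m => M' * τ m) (by simpa using hτlim.const_mul (M' : ℝ)) ?_ hconvK
    -- The derivative of `φ` is taken at the end of the time step, at distance at most `τ m`, and
    -- `M'` is its Lipschitz constant.
    filter_upwards [hτle] with m hm
    refine ae_restrict_of_forall_mem hK₀m fun p hp => ?_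
    obtain ⟨hlt, n, hn, hnt⟩ := Scheme.sub_nextTime_mem (S := S m) hp.2.1
      ((EReal.coe_lt_coe_iff.2 hp.2.2).trans hT')
    have hdist : dist (p.1, (S m).nextTime p.2) p = (S m).nextTime p.2 - p.2 := by
      rw [Prod.dist_eq, dist_self, max_eq_right dist_nonneg, Real.dist_eq,
        abs_of_pos (sub_pos.2 hlt)]
    have hop := (fderiv ℝ φ (p.1, (S m).nextTime p.2) - fderiv ℝ φ p).le_opNorm
      (EuclideanSpace.single j 1, 0)
    have hlip := hM'.dist_le_mul (p.1, (S m).nextTime p.2) p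
    rw [dist_eq_norm, hdist] at hlip
    rw [← Real.norm_eq_abs, ← sub_apply]
    calc _ ≤ _ := hop
      _ ≤ M' * ((S m).nextTime p.2 - p.2) * 1 :=
          mul_le_mul hlip (norm_single_zero_le j) (norm_nonneg _)
            (mul_nonneg M'.coe_nonneg (sub_nonneg.2 hlt.le))
      _ ≤ M' * τ m := by
          rw [mul_one]
          exact mul_le_mul_of_nonneg_left (hnt.trans (hm n hn)) M'.coe_nonneg
  -- the residual vanishes in the limit
  have hRlim : Tendsto (fun m => B * diskArea * ε m + (T' + τ m) * (M * diskArea * ε m +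
      (2 * M * |L| * σ + 2 * M * K * diskArea) * ε m + B * volume.real (closure Ω) * δ m))
      atTop (𝓝 0) := by
    have h1 := ((hεlim.const_mul (M * diskArea)).add (hεlim.const_mul
      (2 * M * |L| * σ + 2 * M * K * diskArea))).add
      (hδlim.const_mul (B * volume.real (closure Ω)))
    simpa using (hεlim.const_mul (B * diskArea)).add ((hτlim.const_add T').mul h1)
  have hres : ∀ᶠ m in atTop, ‖(∫ x in closure Ω, φ (x, 0) • (S m).q 0 x) +
      (∫ p in K₀, fderiv ℝ φ p (0, 1) • (S m).qh p) + ∑ j, ∫ p in K₀,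
        fderiv ℝ φ (p.1, (S m).nextTime p.2) (EuclideanSpace.single j 1, 0) • F j ((S m).qh p)‖ ≤
      B * diskArea * ε m + (T' + τ m) * (M * diskArea * ε m +
      (2 * M * |L| * σ + 2 * M * K * diskArea) * ε m + B * volume.real (closure Ω) * δ m) := by
    filter_upwards [hτle, hδle, hfar, htvb.eventually_lt_const ENNReal.zero_lt_top]
      with m hm1 hm2 hm3 hm4
    have h := (hflux m).norm_weak_residual_le hF hσ (hshape m) (hbalance m)
      ENNReal.toReal_nonneg hm2 (fun n hn => Scheme.exists_oscBound hm4.ne hn) hm1 hφ1 hM hB hm3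
      hT'0 hT' hφT0 (hN m) (hN' m)
    rw [(htime m).2] at h
    have hsum : ∑ n ∈ Finset.range (N m), (S m).dt n • ∫ x in closure Ω,
        ∑ j, fderiv ℝ (fun y => φ (y, (S m).t (n + 1))) x (EuclideanSpace.single j 1) •
          F j ((S m).q n x) = ∑ j, ∫ p in K₀,
        fderiv ℝ φ (p.1, (S m).nextTime p.2) (EuclideanSpace.single j 1, 0) •
          F j ((S m).qh p) := by
      rw [Finset.sum_congr rfl fun j _ => (hspace m j).2.symm]
      rw [Finset.sum_comm]
      refine Finset.sum_congr rfl fun n _ => ?_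
      rw [← Finset.smul_sum, integral_finsetSum]
      intro j _
      simp only [fderiv_section hφ1]
      exact ((hF j).integrableOn_comp ((S m).q_integrable n)
        (S m).mesh.isCompact_closure.measure_lt_top.ne).continuousOn_smul
        (by fun_prop) (S m).mesh.isCompact_closure
    rw [hsum] at h
    exact h
  have hzero := squeeze_zero_norm' hres hRlim
  have hlim := (hA.add hBlim).add (tendsto_finsetSum Finset.univ fun j _ => hClim j)
  rw [← tendsto_nhds_unique hlim hzero, hrestrict
    (fun p => ∑ j, fderiv ℝ φ p (EuclideanSpace.single j 1, 0) • F j (q p))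
    fun p hp => by simp [fderiv_of_notMem_tsupport ℝ hp], integral_finsetSum]
  intro j _
  exact ((hF j).integrableOn_comp hqK hK₀fin).bdd_smul M
    (by fun_prop : Continuous fun p =>
      fderiv ℝ φ p (EuclideanSpace.single j 1, 0)).aestronglyMeasurable
    (.of_forall (abs_fderiv_apply_le hM (norm_single_zero_le j)))

theorem proposition1 {ν : ℕ} (Ω : Set Plane) (hΩ : IsOpen Ω) (T : EReal) (hT : 0 < T)
    -- the conservation law
    (U : Set (State ν)) (hU : IsClosed U)
    (F : Fin 2 → State ν → State ν) (hF : ∃ K : NNReal, ∀ j, LipschitzOnWith K (F j) U)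
    -- a sequence of schemes on shape-regular meshes, with vanishing mesh size and time step
    (S : ℕ → Scheme Ω T ν)
    (hsize : Tendsto (fun m => (S m).mesh.size) atTop (𝓝 0))
    (hstep : Tendsto (fun m => (S m).maxStep) atTop (𝓝 0))
    (hshape : ∃ σ : ℝ, 0 < σ ∧ ∀ m i, ((S m).mesh.cell i).ShapeRegular σ)
    (hflux : ∃ L : ℝ, ∀ m, (S m).AdmissibleFlux F U L)
    -- the local balance with a vanishing conservation defect
    (Δ : (m : ℕ) → ℕ → Fin (S m).mesh.ncell → State ν)
    (hbalance : ∀ m, (S m).Balance (Δ m))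
    (hdefect : Tendsto (fun m => (S m).supDefect (Δ m)) atTop (𝓝 0))
    -- weak convergence of the discrete initial data
    (q₀ : Plane → State ν) (hq₀ : LocallyIntegrableOn q₀ Ω)
    (hinit : ∀ ψ : Plane → ℝ, ContDiff ℝ ∞ ψ → HasCompactSupport ψ → tsupport ψ ⊆ Ω →
      Tendsto (fun m => ∫ x in Ω, ψ x • ((S m).q 0 x - q₀ x)) atTop (𝓝 0))
    -- the total-variation condition
    (htvb : Tendsto (fun m => (S m).supVariation) atTop (𝓝 0))
    -- convergence of the discrete solutions
    (q : Plane × ℝ → State ν) (hq : LocallyIntegrableOn q (spaceTime Ω T))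
    (hconv : ∀ K : Set (Plane × ℝ), IsCompact K → K ⊆ spaceTime Ω T →
      Tendsto (fun m => ∫⁻ p in K, ‖(S m).qh p - q p‖ₑ) atTop (𝓝 0)) :
    IsWeakSolution Ω T U F q₀ q := by

  obtain ⟨K, hK⟩ := hF
  obtain ⟨σ, hσ, hshape⟩ := hshape
  obtain ⟨L, hflux⟩ := hflux
  -- Outside `U` nothing is known about `F`, not even measurability. The extensions `G j` share one
  -- Lipschitz constant and agree with `F j` along `q` almost everywhere.
  choose G hG hFG using fun j => (hK j).extend_finite_dimension
  have hvalues : ∀ᵐ p ∂(volume.restrict (spaceTime Ω T)), q p ∈ U := by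
    refine ae_restrict_spaceTime hΩ (s := {p | q p ∈ U}) fun C hC hCc => ?_
    refine ae_mem_of_tendsto_lintegral_enorm_sub hU
      (hq.integrableOn_compact_subset hC hCc).aestronglyMeasurable.aemeasurable (fun m => ?_)
      (hconv C hCc hC)
    exact ae_restrict_of_forall_mem hCc.measurableSet fun p hp =>
      (hflux m).values _ ((S m).q_mem _) _ (subset_closure (hC hp).1)
  have hae : ∀ j, (fun p => G j (q p)) =ᵐ[volume.restrict (spaceTime Ω T)]
      fun p => F j (q p) := fun j => by
    filter_upwards [hvalues] with p hp
    exact (hFG j hp).symm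
  refine ⟨hvalues, hq, fun j p hp => ?_, fun φ hφ hφc hφΩ => ?_⟩
  · obtain ⟨t, ht, hint⟩ := (hG j).locallyIntegrableOn_comp hq p hp
    refine ⟨t ∩ spaceTime Ω T, inter_mem ht self_mem_nhdsWithin, ?_⟩
    exact (hint.mono_set Set.inter_subset_left).congr_fun_ae
      (ae_restrict_of_ae_restrict_of_subset Set.inter_subset_right (hae j))
  · rw [← weak_form_of_lipschitzWith hΩ hT hG S hsize hstep hσ hshape
      (fun m => (hflux m).congr hFG) hbalance hdefect hq₀ hinit htvb hq hconv hφ hφc hφΩ]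
    congr 1
    refine integral_congr_ae ?_
    filter_upwards [hvalues] with p hp
    exact Finset.sum_congr rfl fun j _ => by rw [hFG j hp]
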